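/- Let $1\le p,q\le\infty$. Let $W^1_p([0,1])$ be the space of absolutely continuous functions $f:[0,1]\to\mathbb R$ with $f'\in L_p([0,1])$, normed by $\|f\|_{W^1_p}=(\|f\|_p^p+\|f'\|_p^p)^{1/p}$ (by $\max(\|f\|_\infty,\|f'\|_\infty)$ if $p=\infty$), and let $F_p$ be its closed unit ball. For points $x_1,\dots,x_n\in[0,1]$ consider the information $N_n(f)=(f(x_1),\dots,f(x_n))$ and its radius for $L_q$-approximation, $$r(N_n)=\inf_{\phi:\mathbb R^n\to L_q([0,1])}\ \sup_{f\in F_p}\ \|f-\phi(N_n(f))\|_{L_q([0,1])},$$ where the infimum is over all mappings $\phi$. Let $r(N_n^*)=\inf_{x_1,\dots,x_n\in[0,1]}r(N_n)$ be the radius of optimal information, and let $\mathbb E[r(N_n)]$ be the expected radius when $x_1,\dots,x_n$ are independent and uniformly distributed in $[0,1]$. For sequences, $a_n\asymp b_n$ means that there is a constant $C\in(0,\infty)$, independent of $n$ (it may depend on $p$ and $q$), such that $a_n\le C\,b_n$ and $b_n\le C\,a_n$ for all $n$ under consideration. Then $r(N_n)$ is, up to modification on a null set, a measurable function of $(x_1,\dots,x_n)$,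 so that $\mathbb E[r(N_n)]$ is well defined, and the following hold. - If $p>q$, then $\mathbb E[r(N_n)]\asymp r(N_n^*)\asymp n^{-1}$ for $n\ge 1$. - If $p\le q$, then $\mathbb E[r(N_n)]\asymp r\big(N^*_{\lfloor n/\log n\rfloor}\big)\asymp\left(\frac{n}{\log n}\right)^{-1+1/p-1/q}$ for $n\ge 2$. -/

import Mathlib

open MeasureTheory
open scoped ENNReal NNReal

noncomputable section

namespace RandomInfo

/-- Lebesgue measure on `[0,1]`. -/
abbrev lebesgue01 : Measure ℝ := volume.restrict (Set.Icc (0 : ℝ) 1)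

/-- Membership in the Sobolev space `W^1_p([0,1])`, in terms of the continuous representative (the
one to which point evaluation refers): `f` is absolutely continuous on `[0,1]` and its derivative,
which exists a.e. and is the weak derivative of `f`, lies in `L_p([0,1])`.
Only the restriction of `f` to `[0,1]` matters. -/
def MemSobolev (p : ℝ≥0∞) (f : ℝ → ℝ) : Prop :=
  AbsolutelyContinuousOnInterval f 0 1 ∧ MemLp (deriv f) p lebesgue01

/-- The norm `(‖f‖_p^p + ‖f'‖_p^p)^(1/p)` of `W^1_p([0,1])`, with the usual modification
`max (‖f‖_∞, ‖f'‖_∞)` for `p = ∞`. -/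
def sobolevNorm (p : ℝ≥0∞) (f : ℝ → ℝ) : ℝ≥0∞ :=
  if p = ∞ then max (eLpNorm f ∞ lebesgue01) (eLpNorm (deriv f) ∞ lebesgue01)
  else (eLpNorm f p lebesgue01 ^ p.toReal + eLpNorm (deriv f) p lebesgue01 ^ p.toReal)
    ^ (1 / p.toReal)

/-- The input class: the unit ball of `W^1_p([0,1])`. -/
def unitBall (p : ℝ≥0∞) : Set (ℝ → ℝ) :=
  {f | MemSobolev p f ∧ sobolevNorm p f ≤ 1}

/-- The information mapping `N_n(f) = (f(x_1), …, f(x_n))`. -/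
def info {n : ℕ} (x : Fin n → unitInterval) (f : ℝ → ℝ) : Fin n → ℝ :=
  fun i => f (x i)

/-- The radius of information for `L_q`-approximation on the unit ball of `W^1_p([0,1])`: the worst
case error of the best algorithm `φ ∘ N_n`, with `φ : ℝⁿ → L_q([0,1])` an arbitrary mapping. -/
def radius (p q : ℝ≥0∞) {n : ℕ} (x : Fin n → unitInterval) : ℝ≥0∞ :=
  ⨅ φ : (Fin n → ℝ) → Lp ℝ q lebesgue01,
    ⨆ f ∈ unitBall p, eLpNorm (fun t => f t - φ (info x f) t) q lebesgue01

/-- The radius `r(N_n^*)` of optimal information given by `n` function values. -/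
def optimalRadius (p q : ℝ≥0∞) (n : ℕ) : ℝ≥0∞ :=
  ⨅ x : Fin n → unitInterval, radius p q x

/-- The expected radius `E[r(N_n)]` for `n` independent points with the uniform distribution on
`[0,1]`; here `volume` on `Fin n → unitInterval` is the `n`-fold product of Lebesgue measure
on `[0,1]`, that is, the joint law of the points. -/
def expectedRadius (p q : ℝ≥0∞) (n : ℕ) : ℝ≥0∞ :=
  ∫⁻ x : Fin n → unitInterval, radius p q x

/-- `a_n ≍ b_n`, for the indices `n ≥ n₀`. -/
def Asymp (n₀ : ℕ) (a b : ℕ → ℝ≥0∞) : Prop :=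
  ∃ C : ℝ≥0, 0 < C ∧ ∀ n : ℕ, n₀ ≤ n → a n ≤ C * b n ∧ b n ≤ C * a n

end RandomInfo

end

/-! Throughout, `p⁻¹.toReal` is `1/p`, with value `0` at `p = ∞`.

Upper bounds. Two functions in the ball with the same data agree at the nodes, so their difference
at `t` is at most the integral of `|f' - g'|` over the gap between nodes containing `t`
(`enorm_sub_le_setLIntegral`). Hölder's inequality on each gap, followed by averaging over gaps,
bounds the `L_q` norm of the difference. For `p ≤ q` the bound is a multiple of (longest gap)`^(1 -
1/p + 1/q)`; for `q < p` it involves only a moment of the length of the gap at a uniform point. This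
is why the logarithm appears in one case and not in the other: a gap at a fixed point has length of
order `1/n` with exponential tails (`lintegral_length_pow_le`), while the longest of all gaps is of
order `log n / n`, as in the coupon collector problem.

Lower bounds. A function in the ball that vanishes at all nodes cannot be told apart from its
negative, so its norm bounds the radius from below (`eLpNorm_le_radius`). A tent on an empty
interval gives the rate for `p ≤ q` (`rpow_le_radius`). Empty cells of length of order `log n / n`
exist with probability at least `1/2` by the second moment method, and an empty cell among `n + 1`
always exists by pigeonhole. For `q < p`, half the distance to the nodes is a suitable function for
any choice of nodes (`inv_le_optimalRadius`). The optimal radius never exceeds the expected one, so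
a lower bound for the former and an upper bound for the latter settle that case.

Measurability. Nodes close to given distinct interior nodes are their images under a map of `[0,1]`
that is nearly the identity in `C^1`; such a map changes the radius by a factor close to `1`
(`IsReparam.radius_le`). Hence the radius is upper semicontinuous on an open set of full measure. -/

namespace RandomInfo

open Set Filter Topology

/-! ### Stability of the radius under reparametrisation of `[0,1]`. -/

/-- Change of variables yields the factor `c^(1/p)`. It is rounded up to `c` so that one constant
serves every exponent, including `∞`. -/
lemma eLpNorm_comp_le_of_map_le {μ : Measure ℝ} {T : ℝ → ℝ} {c : ℝ≥0∞} (hc : 1 ≤ c)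
    (hT : AEMeasurable T μ) (hmap : μ.map T ≤ c • μ) {p : ℝ≥0∞} (hp : 1 ≤ p)
    {g : ℝ → ℝ} (hg : AEStronglyMeasurable g μ) :
    eLpNorm (fun t => g (T t)) p μ ≤ c * eLpNorm g p μ := by
  have hg' : AEStronglyMeasurable g (μ.map T) :=
    (hg.smul_measure c).mono_measure hmap
  have h1 := eLpNorm_map_measure (p := p) hg' hT
  have h2 : eLpNorm (fun t => g (T t)) p μ = eLpNorm (g ∘ T) p μ := rfl
  rw [h2, ← h1]
  refine (eLpNorm_mono_measure g hmap).trans ?_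
  rw [eLpNorm_smul_measure_of_ne_zero (by positivity), smul_eq_mul]
  gcongr
  calc c ^ (1 / p).toReal ≤ c ^ (1 : ℝ) := by
        apply ENNReal.rpow_le_rpow_of_exponent_le hc
        have : (1 / p) ≤ 1 := by simpa using hp
        simpa using ENNReal.toReal_mono ENNReal.one_ne_top this
    _ = c := ENNReal.rpow_one c

lemma sobolevNorm_le_mul {p : ℝ≥0∞} (hp : 1 ≤ p) {f g : ℝ → ℝ} {c : ℝ≥0∞}
    (h0 : eLpNorm f p lebesgue01 ≤ c * eLpNorm g p lebesgue01)
    (h1 : eLpNorm (deriv f) p lebesgue01 ≤ c * eLpNorm (deriv g) p lebesgue01) :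
    sobolevNorm p f ≤ c * sobolevNorm p g := by
  unfold sobolevNorm
  split_ifs with h
  · subst h
    refine max_le (h0.trans ?_) (h1.trans ?_) <;> gcongr
    · exact le_max_left _ _
    · exact le_max_right _ _
  · have hp0 : 0 < p.toReal := ENNReal.toReal_pos (by positivity) h
    calc _ ≤ ((c * eLpNorm g p lebesgue01) ^ p.toReal
          + (c * eLpNorm (deriv g) p lebesgue01) ^ p.toReal) ^ (1 / p.toReal) := by gcongr
      _ = _ := by
        rw [ENNReal.mul_rpow_of_nonneg _ _ hp0.le, ENNReal.mul_rpow_of_nonneg _ _ hp0.le,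
          ← mul_add, ENNReal.mul_rpow_of_nonneg _ _ (by positivity), ← ENNReal.rpow_mul,
          mul_one_div_cancel hp0.ne', ENNReal.rpow_one]

/-- Monotonicity keeps the images of disjoint intervals disjoint, and the Lipschitz bound controls
their total length. -/
lemma absolutelyContinuousOnInterval_comp {f T : ℝ → ℝ} {K : ℝ≥0}
    (hf : AbsolutelyContinuousOnInterval f 0 1) (hmono : MonotoneOn T (Icc 0 1))
    (hlip : LipschitzOnWith K T (Icc 0 1)) (hmaps : MapsTo T (Icc 0 1) (Icc 0 1)) :
    AbsolutelyContinuousOnInterval (fun t => f (T t)) 0 1 := by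
  rw [absolutelyContinuousOnInterval_iff] at hf ⊢
  intro ε hε
  obtain ⟨δ, hδ, h⟩ := hf ε hε
  refine ⟨δ / (K + 1), by positivity, fun E hE hlen => ?_⟩
  have hI : uIcc (0 : ℝ) 1 = Icc 0 1 := uIcc_of_le zero_le_one
  simp only [AbsolutelyContinuousOnInterval.disjWithin, mem_ofPred_eq, hI] at hE h
  refine h (E.1, fun i => (T (E.2 i).1, T (E.2 i).2)) ⟨fun i hi => ?_, ?_⟩ ?_
  · exact ⟨hmaps (hE.1 i hi).1, hmaps (hE.1 i hi).2⟩
  · intro i hi j hj hij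
    have hd := hE.2 hi hj hij
    simp only [Function.onFun] at hd ⊢
    have hi' := hE.1 i hi
    have hj' := hE.1 j hj
    rw [Set.disjoint_left] at hd ⊢
    intro u hui huj
    simp only [mem_uIoc] at hui huj hd
    generalize (E.2 i).1 = a at *
    generalize (E.2 i).2 = b at *
    generalize (E.2 j).1 = a' at *
    generalize (E.2 j).2 = b' at *
    -- If the images of `(a, b]` and `(a', b']` share a point `u`, then `min b b'` lies in both
    -- intervals. The end points of each interval may come in either order, hence four cases below.
    have key : ∀ a b a' b' : ℝ, a ∈ Icc (0:ℝ) 1 → b ∈ Icc (0:ℝ) 1 → a' ∈ Icc (0:ℝ) 1 →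
        b' ∈ Icc (0:ℝ) 1 → T a < u → u ≤ T b → T a' < u → u ≤ T b' →
        a < min b b' ∧ a' < min b b' := by
      intro a b a' b' ha hb ha' hb' h1 h2 h3 h4
      have lt : ∀ a b : ℝ, a ∈ Icc (0:ℝ) 1 → b ∈ Icc (0:ℝ) 1 → T a < u → u ≤ T b → a < b := by
        intro a b ha hb h1 h2
        by_contra hab
        have := hmono hb ha (not_lt.1 hab)
        linarith
      exact ⟨lt_min (lt _ _ ha hb h1 h2) (lt _ _ ha hb' h1 h4),
        lt_min (lt _ _ ha' hb h3 h2) (lt _ _ ha' hb' h3 h4)⟩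
    rcases hui with hui | hui <;> rcases huj with huj | huj
    · have := key a b a' b' hi'.1 hi'.2 hj'.1 hj'.2 hui.1 hui.2 huj.1 huj.2
      have := @hd (min b b')
      grind
    · have := key a b b' a' hi'.1 hi'.2 hj'.2 hj'.1 hui.1 hui.2 huj.1 huj.2
      have := @hd (min b a')
      grind
    · have := key b a a' b' hi'.2 hi'.1 hj'.1 hj'.2 hui.1 hui.2 huj.1 huj.2
      have := @hd (min a b')
      grind
    · have := key b a b' a' hi'.2 hi'.1 hj'.2 hj'.1 hui.1 hui.2 huj.1 huj.2
      have := @hd (min a a')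
      grind
  · calc ∑ i ∈ Finset.range E.1, dist (T (E.2 i).1) (T (E.2 i).2)
        ≤ ∑ i ∈ Finset.range E.1, K * dist (E.2 i).1 (E.2 i).2 :=
          Finset.sum_le_sum fun i hi => hlip.dist_le_mul _ (hE.1 i hi).1 _ (hE.1 i hi).2
      _ = K * ∑ i ∈ Finset.range E.1, dist (E.2 i).1 (E.2 i).2 := (Finset.mul_sum ..).symm
      _ ≤ K * (δ / (K + 1)) := by gcongr
      _ < δ := by
        rw [mul_div_assoc', div_lt_iff₀ (by positivity)]
        nlinarith

/-- `T` is a differentiable bijection of `[0,1]` fixing the end points, with derivative between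
`c⁻¹` and `c`. -/
structure IsReparam (T T' : ℝ → ℝ) (c : ℝ) : Prop where
  one_le : 1 ≤ c
  hasDerivAt : ∀ t, HasDerivAt T (T' t) t
  lower : ∀ t ∈ Icc (0 : ℝ) 1, c⁻¹ ≤ T' t
  upper : ∀ t ∈ Icc (0 : ℝ) 1, T' t ≤ c
  map_zero : T 0 = 0
  map_one : T 1 = 1

namespace IsReparam

variable {T T' : ℝ → ℝ} {c : ℝ}

lemma continuous (h : IsReparam T T' c) : Continuous T :=
  continuous_iff_continuousAt.2 fun t => (h.hasDerivAt t).continuousAt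

lemma pos (h : IsReparam T T' c) : 0 < c := zero_lt_one.trans_le h.one_le

lemma strictMonoOn (h : IsReparam T T' c) : StrictMonoOn T (Icc 0 1) := by
  apply strictMonoOn_of_deriv_pos (convex_Icc 0 1) h.continuous.continuousOn
  intro t ht
  rw [(h.hasDerivAt t).deriv]
  exact (inv_pos.2 h.pos).trans_le (h.lower t (interior_subset ht))

lemma mapsTo (h : IsReparam T T' c) : MapsTo T (Icc 0 1) (Icc 0 1) := by
  intro t ht
  have h0 := h.strictMonoOn.monotoneOn (left_mem_Icc.2 zero_le_one) ht ht.1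
  have h1 := h.strictMonoOn.monotoneOn ht (right_mem_Icc.2 zero_le_one) ht.2
  rw [h.map_zero] at h0
  rw [h.map_one] at h1
  exact ⟨h0, h1⟩

lemma surjOn (h : IsReparam T T' c) : SurjOn T (Icc 0 1) (Icc 0 1) := by
  have := intermediate_value_Icc (zero_le_one (α := ℝ)) (f := T) h.continuous.continuousOn
  rwa [h.map_zero, h.map_one] at this

lemma lipschitzOnWith (h : IsReparam T T' c) : LipschitzOnWith c.toNNReal T (Icc 0 1) := by
  apply (convex_Icc (0 : ℝ) 1).lipschitzOnWith_of_nnnorm_hasDerivWithin_le (f' := T')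
  · exact fun t _ => (h.hasDerivAt t).hasDerivWithinAt
  · intro t ht
    rw [← NNReal.coe_le_coe, coe_nnnorm, Real.coe_toNNReal _ h.pos.le, Real.norm_eq_abs,
      abs_of_nonneg ((inv_pos.2 h.pos).le.trans (h.lower t ht))]
    exact h.upper t ht

lemma volume_image (h : IsReparam T T' c) {A : Set ℝ} (hA : MeasurableSet A)
    (hA' : A ⊆ Icc 0 1) :
    volume (T '' A) = ∫⁻ t in A, ENNReal.ofReal (T' t) := by
  have := lintegral_image_eq_lintegral_abs_deriv_mul hA
    (fun t _ => (h.hasDerivAt t).hasDerivWithinAt) (h.strictMonoOn.injOn.mono hA') 1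
  simp only [Pi.one_apply, lintegral_one, Measure.restrict_apply_univ, mul_one] at this
  rw [this]
  refine setLIntegral_congr_fun hA fun t ht => ?_
  rw [abs_of_nonneg ((inv_pos.2 h.pos).le.trans (h.lower t (hA' ht)))]

/-- The image measure has density `1/T'`, which is at most `c`. For the inverse in `exists_inverse`
the density is `T'`, again at most `c`. -/
lemma map_le (h : IsReparam T T' c) :
    lebesgue01.map T ≤ ENNReal.ofReal c • lebesgue01 := by
  refine Measure.le_iff.2 fun s hs => ?_
  rw [Measure.map_apply h.continuous.measurable hs, Measure.smul_apply,
    Measure.restrict_apply (h.continuous.measurable hs), Measure.restrict_apply hs, smul_eq_mul]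
  set A := T ⁻¹' s ∩ Icc 0 1
  have hA : MeasurableSet A := (h.continuous.measurable hs).inter measurableSet_Icc
  have h1 : volume (T '' A) ≤ volume (s ∩ Icc 0 1) := by
    apply measure_mono
    rintro _ ⟨t, ht, rfl⟩
    exact ⟨ht.1, h.mapsTo ht.2⟩
  rw [h.volume_image hA inter_subset_right] at h1
  have h2 : ENNReal.ofReal c⁻¹ * volume A ≤ ∫⁻ t in A, ENNReal.ofReal (T' t) := by
    rw [← setLIntegral_const]
    exact setLIntegral_mono' hA fun t ht => ENNReal.ofReal_le_ofReal (h.lower t ht.2)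
  calc volume A = ENNReal.ofReal c * (ENNReal.ofReal c⁻¹ * volume A) := by
        rw [← mul_assoc, ← ENNReal.ofReal_mul h.pos.le, mul_inv_cancel₀ h.pos.ne']
        simp
    _ ≤ _ := by gcongr; exact h2.trans h1

lemma exists_inverse (h : IsReparam T T' c) :
    ∃ S : ℝ → ℝ, AEMeasurable S lebesgue01 ∧ (∀ u ∈ Icc (0 : ℝ) 1, T (S u) = u) ∧
      lebesgue01.map S ≤ ENNReal.ofReal c • lebesgue01 := by
  have hsurj : ∀ u ∈ Icc (0 : ℝ) 1, ∃ t, t ∈ Icc (0 : ℝ) 1 ∧ T t = u := h.surjOn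
  choose! S hSI hS using hsurj
  have hmono : MonotoneOn S (Icc 0 1) := by
    intro u hu v hv huv
    by_contra hlt
    have := h.strictMonoOn (hSI v hv) (hSI u hu) (not_le.1 hlt)
    rw [hS u hu, hS v hv] at this
    linarith
  have hm : AEMeasurable S lebesgue01 := aemeasurable_restrict_of_monotoneOn measurableSet_Icc hmono
  refine ⟨S, hm, fun u hu => hS u hu, Measure.le_iff.2 fun s hs => ?_⟩
  rw [Measure.map_apply_of_aemeasurable hm hs, Measure.smul_apply, Measure.restrict_apply hs,
    smul_eq_mul]
  have h1 : lebesgue01 (S ⁻¹' s) ≤ volume (T '' (s ∩ Icc 0 1)) := by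
    rw [Measure.restrict_apply' measurableSet_Icc]
    apply measure_mono
    intro u hu
    exact ⟨S u, ⟨hu.1, hSI u hu.2⟩, hS u hu.2⟩
  refine h1.trans ?_
  rw [h.volume_image (hs.inter measurableSet_Icc) inter_subset_right, ← setLIntegral_const]
  exact setLIntegral_mono' (hs.inter measurableSet_Icc)
    fun t ht => ENNReal.ofReal_le_ofReal (h.upper t ht.2)

/-- The chain rule can fail only where `T t` hits the null set on which `f` is not differentiable;
by `map_le` the preimage of that set is null. -/
lemma ae_deriv_comp (h : IsReparam T T' c) {f : ℝ → ℝ}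
    (hf : AbsolutelyContinuousOnInterval f 0 1) :
    ∀ᵐ t ∂lebesgue01, deriv (fun t => f (T t)) t = deriv f (T t) * T' t := by
  have h1 : ∀ᵐ u ∂lebesgue01, DifferentiableAt ℝ f u := by
    have := hf.ae_differentiableAt
    rw [ae_restrict_iff' measurableSet_Icc]
    simpa [uIcc_of_le (zero_le_one (α := ℝ))] using this
  have h2 : ∀ᵐ u ∂(lebesgue01.map T), DifferentiableAt ℝ f u :=
    (h.map_le.absolutelyContinuous.trans Measure.smul_absolutelyContinuous) h1
  filter_upwards [ae_of_ae_map h.continuous.measurable.aemeasurable h2] with t ht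
  exact (ht.hasDerivAt.comp t (h.hasDerivAt t)).deriv

/-- Of the two factors `c`, one comes from `T'` in the chain rule and one from the change of
variables in the norm. -/
lemma comp_mem_unitBall (h : IsReparam T T' c) {p : ℝ≥0∞} (hp : 1 ≤ p) {f : ℝ → ℝ}
    (hf : f ∈ unitBall p) : (fun t => (c ^ 2)⁻¹ * f (T t)) ∈ unitBall p := by
  obtain ⟨⟨hac, hmem⟩, hnorm⟩ := hf
  have hc := h.pos
  have hc1 : 1 ≤ ENNReal.ofReal c := by simpa using h.one_le
  have hTm : AEMeasurable T lebesgue01 := h.continuous.measurable.aemeasurable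
  have hfm : AEStronglyMeasurable f lebesgue01 :=
    (by simpa [uIcc_of_le (zero_le_one (α := ℝ))] using hac.continuousOn :
      ContinuousOn f (Icc 0 1)).aestronglyMeasurable measurableSet_Icc
  have hac' : AbsolutelyContinuousOnInterval (fun t => f (T t)) 0 1 :=
    absolutelyContinuousOnInterval_comp hac h.strictMonoOn.monotoneOn h.lipschitzOnWith h.mapsTo
  have hder : eLpNorm (deriv fun t => f (T t)) p lebesgue01
      ≤ ENNReal.ofReal (c ^ 2) * eLpNorm (deriv f) p lebesgue01 := by
    have h1 : eLpNorm (deriv fun t => f (T t)) p lebesgue01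
        ≤ ENNReal.ofReal c * eLpNorm (fun t => deriv f (T t)) p lebesgue01 := by
      apply eLpNorm_le_mul_eLpNorm_of_ae_le_mul
      filter_upwards [h.ae_deriv_comp hac, ae_restrict_mem measurableSet_Icc] with t ht htI
      rw [ht, norm_mul, mul_comm, Real.norm_of_nonneg ((inv_pos.2 hc).le.trans (h.lower t htI))]
      gcongr
      exact h.upper t htI
    refine h1.trans ?_
    rw [pow_two, ENNReal.ofReal_mul hc.le, mul_assoc]
    gcongr
    exact eLpNorm_comp_le_of_map_le hc1 hTm h.map_le hp hmem.1
  have hval : eLpNorm (fun t => f (T t)) p lebesgue01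
      ≤ ENNReal.ofReal (c ^ 2) * eLpNorm f p lebesgue01 := by
    refine (eLpNorm_comp_le_of_map_le hc1 hTm h.map_le hp hfm).trans ?_
    gcongr
    nlinarith [h.one_le]
  have hderiv : (deriv fun t => (c ^ 2)⁻¹ * f (T t))
      = (c ^ 2)⁻¹ • deriv fun t => f (T t) := by
    ext t
    simp [deriv_const_mul_field]
  have hen : ‖(c ^ 2)⁻¹‖ₑ * ENNReal.ofReal (c ^ 2) = 1 := by
    rw [Real.enorm_of_nonneg (by positivity), ← ENNReal.ofReal_mul (by positivity),
      inv_mul_cancel₀ (by positivity), ENNReal.ofReal_one]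
  refine ⟨⟨hac'.const_mul _, ?_⟩, ?_⟩
  · rw [hderiv]
    refine MemLp.const_smul ⟨(measurable_deriv _).aestronglyMeasurable, ?_⟩ _
    exact hder.trans_lt (ENNReal.mul_lt_top ENNReal.ofReal_lt_top hmem.2)
  · refine (sobolevNorm_le_mul hp (c := 1) (g := f) ?_ ?_).trans (by rwa [one_mul])
    · have : (fun t => (c ^ 2)⁻¹ * f (T t)) = (c ^ 2)⁻¹ • fun t => f (T t) := rfl
      rw [this, eLpNorm_const_smul, ← hen, mul_assoc]
      gcongr
    · rw [hderiv, eLpNorm_const_smul, ← hen, mul_assoc]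
      gcongr

lemma radius_le (h : IsReparam T T' c) {p q : ℝ≥0∞} (hp : 1 ≤ p) (hq : 1 ≤ q) {n : ℕ}
    {x x' : Fin n → unitInterval} (hx : ∀ i, T (x i) = x' i) :
    radius p q x' ≤ ENNReal.ofReal (c ^ 3) * radius p q x := by
  have hc := h.pos
  have hc1 : 1 ≤ ENNReal.ofReal c := by simpa using h.one_le
  obtain ⟨S, hSm, hTS, hSmap⟩ := h.exists_inverse
  have hofReal : ENNReal.ofReal (c ^ 3) ≠ 0 := by simp; positivity
  unfold radius
  rw [ENNReal.mul_iInf_of_ne hofReal ENNReal.ofReal_ne_top]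
  refine le_iInf fun φ => ?_
  have hmem : ∀ g : Lp ℝ q lebesgue01, MemLp (fun u => c ^ 2 * g (S u)) q lebesgue01 := by
    intro g
    refine MemLp.const_mul ⟨?_, ?_⟩ (c ^ 2)
    · exact ((Lp.aestronglyMeasurable g).smul_measure _ |>.mono_measure hSmap).comp_aemeasurable hSm
    · exact (eLpNorm_comp_le_of_map_le hc1 hSm hSmap hq (Lp.aestronglyMeasurable g)).trans_lt
        (ENNReal.mul_lt_top ENNReal.ofReal_lt_top (Lp.memLp g).2)
  -- An algorithm for the nodes `x` is transported to `x'`: the function `(c^2)⁻¹ f ∘ T` is in the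
  -- ball and its data at `x` are the rescaled data of `f` at `x'`. Undoing the transport by `S`
  -- costs `c^2` for the rescaling and `c` for the change of variables.
  refine iInf_le_of_le (fun y => (hmem (φ fun i => (c ^ 2)⁻¹ * y i)).toLp) ?_
  refine iSup₂_le fun f hf => ?_
  set g : ℝ → ℝ := fun t => (c ^ 2)⁻¹ * f (T t) with hg
  have hgball : g ∈ unitBall p := h.comp_mem_unitBall hp hf
  have hinfo : (fun i => (c ^ 2)⁻¹ * info x' f i) = info x g := by
    ext i
    simp [info, hg, hx]
  beta_reduce
  rw [hinfo]
  have hgm : AEStronglyMeasurable g lebesgue01 :=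
    (by simpa [uIcc_of_le (zero_le_one (α := ℝ))] using hgball.1.1.continuousOn :
      ContinuousOn g (Icc 0 1)).aestronglyMeasurable measurableSet_Icc
  set ψ : Lp ℝ q lebesgue01 := (hmem (φ (info x g))).toLp with hψ
  have hψae : ψ =ᵐ[lebesgue01] fun u => c ^ 2 * φ (info x g) (S u) :=
    (hmem (φ (info x g))).coeFn_toLp
  set d : ℝ → ℝ := fun t => g t - φ (info x g) t with hd
  have hdm : AEStronglyMeasurable d lebesgue01 := hgm.sub (Lp.aestronglyMeasurable _)
  have hcomp : eLpNorm (fun u => d (S u)) q lebesgue01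
      ≤ ENNReal.ofReal c * eLpNorm d q lebesgue01 :=
    eLpNorm_comp_le_of_map_le hc1 hSm hSmap hq hdm
  have hle : eLpNorm d q lebesgue01
      ≤ ⨆ f ∈ unitBall p, eLpNorm (fun t => f t - φ (info x f) t) q lebesgue01 :=
    le_iSup₂_of_le g hgball le_rfl
  have heq : eLpNorm (fun t => f t - ψ t) q lebesgue01
      = eLpNorm (c ^ 2 • fun u => d (S u)) q lebesgue01 := by
    apply eLpNorm_congr_ae
    filter_upwards [hψae, ae_restrict_mem measurableSet_Icc] with u hu huI
    rw [hu]
    simp only [hd, hg, Pi.smul_apply, smul_eq_mul, hTS u huI]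
    field_simp
  rw [heq, eLpNorm_const_smul, Real.enorm_of_nonneg (by positivity),
    pow_succ c 2, ENNReal.ofReal_mul (by positivity), mul_assoc]
  gcongr
  exact hcomp.trans (by gcongr)

end IsReparam

/-! ### Perturbation of the nodes and measurability of the radius. -/

/-- A polynomial bump that is nonzero at `x i` and vanishes at `0`, `1` and at the other nodes. -/
def nodeBump {n : ℕ} (x : Fin n → unitInterval) (i : Fin n) (t : ℝ) : ℝ :=
  t * (1 - t) * ∏ j ∈ Finset.univ.erase i, (t - x j)

lemma contDiff_nodeBump {n : ℕ} (x : Fin n → unitInterval) (i : Fin n) :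
    ContDiff ℝ 1 (nodeBump x i) := by
  unfold nodeBump
  refine (contDiff_id.mul (contDiff_const.sub contDiff_id)).mul ?_
  exact contDiff_prod fun j _ => contDiff_id.sub contDiff_const

/-- The configurations of distinct nodes in the open interval. -/
def regularNodes (n : ℕ) : Set (Fin n → unitInterval) :=
  {x | (∀ i j, i ≠ j → x i ≠ x j) ∧ ∀ i, 0 < (x i : ℝ) ∧ (x i : ℝ) < 1}

lemma isOpen_regularNodes (n : ℕ) : IsOpen (regularNodes n) := by
  have : regularNodes n = (⋂ i, ⋂ j, ⋂ (_ : i ≠ j), {x | x i ≠ x j}) ∩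
      ⋂ i, ({x | 0 < (x i : ℝ)} ∩ {x | (x i : ℝ) < 1}) := by
    ext x
    simp [regularNodes]
  rw [this]
  refine IsOpen.inter ?_ ?_
  · refine isOpen_iInter_of_finite fun i => isOpen_iInter_of_finite fun j =>
      isOpen_iInter_of_finite fun _ => ?_
    exact isOpen_ne_fun (by fun_prop) (by fun_prop)
  · refine isOpen_iInter_of_finite fun i => ?_
    exact (isOpen_lt (by fun_prop) (by fun_prop)).inter (isOpen_lt (by fun_prop) (by fun_prop))

lemma nodeBump_self_ne_zero {n : ℕ} {x : Fin n → unitInterval} (hx : x ∈ regularNodes n)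
    (i : Fin n) : nodeBump x i (x i) ≠ 0 := by
  have h := hx.2 i
  refine mul_ne_zero (mul_ne_zero h.1.ne' (sub_pos.2 h.2).ne') ?_
  refine Finset.prod_ne_zero_iff.2 fun j hj => sub_ne_zero.2 fun hij => ?_
  exact hx.1 i j (Finset.ne_of_mem_erase hj).symm (Subtype.ext hij)

lemma nodeBump_of_ne {n : ℕ} (x : Fin n → unitInterval) {i k : Fin n} (hik : k ≠ i) :
    nodeBump x i (x k) = 0 := by
  unfold nodeBump
  rw [Finset.prod_eq_zero (Finset.mem_erase.2 ⟨hik, Finset.mem_univ k⟩) (sub_self _), mul_zero]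

/-- The identity is corrected by Lagrange-type interpolation of the displacements `x' i - x i`. The
basis functions depend on `x` alone, so the derivative of the correction tends to `0` uniformly on
`[0,1]` as `x' → x`. -/
lemma eventually_exists_isReparam {n : ℕ} {x : Fin n → unitInterval} (hx : x ∈ regularNodes n)
    {c : ℝ} (hc : 1 < c) :
    ∀ᶠ x' in 𝓝 x, ∃ T T' : ℝ → ℝ, IsReparam T T' c ∧ ∀ i, T (x i) = x' i := by
  set b : Fin n → ℝ → ℝ := fun i t => (nodeBump x i (x i))⁻¹ * nodeBump x i t with hb
  have hbC : ∀ i, ContDiff ℝ 1 (b i) := fun i => contDiff_const.mul (contDiff_nodeBump x i)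
  have hbd : ∀ i t, HasDerivAt (b i) (deriv (b i) t) t := fun i t =>
    ((hbC i).differentiable (by norm_num) t).hasDerivAt
  have hM : ∀ i, ∃ M : ℝ, ∀ t ∈ Icc (0 : ℝ) 1, ‖deriv (b i) t‖ ≤ M := fun i =>
    isCompact_Icc.exists_bound_of_continuousOn
      ((hbC i).continuous_deriv (by norm_num)).continuousOn
  choose M hM using hM
  have hc0 : 0 < c := by linarith
  have hε : 0 < 1 - c⁻¹ := by
    rw [sub_pos]
    exact inv_lt_one_of_one_lt₀ hc
  -- Since `c + c⁻¹ ≥ 2`, the single bound `1 - c⁻¹` on the perturbation of the derivative gives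
  -- both the lower bound `c⁻¹` and the upper bound `c`.
  have hεc : 1 + (1 - c⁻¹) ≤ c := by
    have : c * c⁻¹ = 1 := mul_inv_cancel₀ hc0.ne'
    nlinarith [inv_pos.2 hc0, sq_nonneg (c - 1)]
  have hcont : Tendsto (fun x' : Fin n → unitInterval => ∑ i, |(x' i : ℝ) - x i| * M i)
      (𝓝 x) (𝓝 0) := by
    have : Continuous fun x' : Fin n → unitInterval => ∑ i, |(x' i : ℝ) - x i| * M i := by
      fun_prop
    simpa using this.tendsto x
  filter_upwards [hcont.eventually_lt_const hε] with x' hx'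
  have hbound : ∀ t ∈ Icc (0 : ℝ) 1, |∑ i, ((x' i : ℝ) - x i) * deriv (b i) t| ≤ 1 - c⁻¹ := by
    intro t ht
    refine ((Finset.abs_sum_le_sum_abs _ _).trans (Finset.sum_le_sum fun i _ => ?_)).trans hx'.le
    rw [abs_mul]
    gcongr
    exact hM i t ht
  refine ⟨fun t => t + ∑ i, ((x' i : ℝ) - x i) * b i t,
    fun t => 1 + ∑ i, ((x' i : ℝ) - x i) * deriv (b i) t, ⟨hc.le, ?_, ?_, ?_, ?_, ?_⟩, ?_⟩
  · intro t
    exact (hasDerivAt_id t).add (HasDerivAt.fun_sum fun i _ => (hbd i t).const_mul _)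
  · intro t ht
    have := (abs_le.1 (hbound t ht)).1
    linarith
  · intro t ht
    have := (abs_le.1 (hbound t ht)).2
    linarith
  · simp [hb, nodeBump]
  · simp [hb, nodeBump]
  · intro k
    beta_reduce
    rw [Finset.sum_eq_single k]
    · simp [hb, nodeBump_self_ne_zero hx k]
    · intro i _ hik
      simp [hb, nodeBump_of_ne x hik.symm]
    · simp

lemma ae_mem_regularNodes (n : ℕ) : ∀ᵐ x : Fin n → unitInterval, x ∈ regularNodes n := by
  have h1 : ∀ i j : Fin n, i ≠ j → ∀ᵐ x : Fin n → unitInterval, x i ≠ x j := by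
    intro i j hij
    have hind := (ProbabilityTheory.iIndepFun_pi (𝓧 := fun _ : Fin n => unitInterval)
      (μ := fun _ : Fin n => (volume : Measure unitInterval)) (X := fun _ => id)
      (fun _ => aemeasurable_id)).indepFun hij
    replace hind : ProbabilityTheory.IndepFun (fun ω : Fin n → unitInterval => ω i)
        (fun ω => ω j) (Measure.pi fun _ => volume) := hind
    rw [ProbabilityTheory.indepFun_iff_map_prod_eq_prod_map_map
      (measurable_pi_apply i).aemeasurable (measurable_pi_apply j).aemeasurable] at hind
    have hi : ∀ i : Fin n, (Measure.pi fun _ : Fin n => (volume : Measure unitInterval)).map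
        (fun x => x i) = volume := fun i =>
      (measurePreserving_eval (fun _ : Fin n => (volume : Measure unitInterval)) i).map_eq
    rw [hi, hi] at hind
    have hdiag : ∀ᵐ z ∂((volume : Measure unitInterval).prod volume), z.1 ≠ z.2 := by
      have hms : MeasurableSet {z : unitInterval × unitInterval | z.1 ≠ z.2} :=
        (isOpen_ne_fun continuous_fst continuous_snd).measurableSet
      rw [Measure.ae_prod_iff_ae_ae hms]
      refine Eventually.of_forall fun u => ?_
      have : ∀ᵐ v : unitInterval, v ≠ u := by simp [ae_iff]
      filter_upwards [this] with v hv using hv.symm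
    rw [← hind] at hdiag
    exact ae_of_ae_map (f := fun x : Fin n → unitInterval => (x i, x j))
      (p := fun z => z.1 ≠ z.2) (by fun_prop) hdiag
  have h2 : ∀ (i : Fin n) (u : unitInterval), ∀ᵐ x : Fin n → unitInterval, x i ≠ u := by
    intro i u
    have : ∀ᵐ v : unitInterval, v ≠ u := by simp [ae_iff]
    exact (measurePreserving_eval
      (fun _ : Fin n => (volume : Measure unitInterval)) i).quasiMeasurePreserving.ae this
  have h1' : ∀ᵐ x : Fin n → unitInterval, ∀ i j, i ≠ j → x i ≠ x j := by
    simp only [ae_all_iff]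
    exact h1
  have h2' : ∀ᵐ x : Fin n → unitInterval, ∀ i, x i ≠ 0 ∧ x i ≠ 1 := by
    rw [ae_all_iff]
    exact fun i => (h2 i 0).and (h2 i 1)
  filter_upwards [h1', h2'] with x hx hx'
  exact ⟨hx, fun i => ⟨unitInterval.pos_iff_ne_zero.2 (hx' i).1,
    unitInterval.lt_one_iff_ne_one.2 (hx' i).2⟩⟩

lemma aemeasurable_radius {p q : ℝ≥0∞} (hp : 1 ≤ p) (hq : 1 ≤ q) (n : ℕ) :
    AEMeasurable (fun x : Fin n → unitInterval => radius p q x) volume := by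
  classical
  -- The value `⊤` off the open set `regularNodes n` makes upper semicontinuity trivial there; on
  -- the set it follows by letting `c` decrease to `1`.
  refine ⟨fun x => if x ∈ regularNodes n then radius p q x else ⊤, ?_, ?_⟩
  · refine UpperSemicontinuous.measurable fun x ρ hρ => ?_
    beta_reduce at hρ
    split_ifs at hρ with hx
    · have hlim : Tendsto (fun c : ℝ => ENNReal.ofReal (c ^ 3) * radius p q x) (𝓝[>] 1)
          (𝓝 (radius p q x)) := by
        have h1 : Tendsto (fun c : ℝ => ENNReal.ofReal (c ^ 3)) (𝓝[>] 1) (𝓝 1) := by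
          have : Continuous fun c : ℝ => ENNReal.ofReal (c ^ 3) := 
            ENNReal.continuous_ofReal.comp (by fun_prop)
          simpa using (this.tendsto 1).mono_left nhdsWithin_le_nhds
        simpa using ENNReal.Tendsto.mul_const h1 (Or.inl one_ne_zero)
      obtain ⟨c, hcρ, hc⟩ :=
        ((hlim.eventually_lt_const hρ).and self_mem_nhdsWithin).exists
      filter_upwards [eventually_exists_isReparam hx hc,
        (isOpen_regularNodes n).mem_nhds hx] with x' ⟨T, T', hT, hTx⟩ hx'
      rw [if_pos hx']
      exact (hT.radius_le hp hq hTx).trans_lt hcρ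
    · exact absurd hρ not_top_lt
  · filter_upwards [ae_mem_regularNodes n] with x hx
    rw [if_pos hx]

/-! ### Hölder estimates over a partition of `[0,1)`. -/

lemma lebesgue01_eq_restrict_Ico : lebesgue01 = volume.restrict (Ico (0 : ℝ) 1) :=
  (Measure.restrict_congr_set Ico_ae_eq_Icc).symm

instance : IsProbabilityMeasure lebesgue01 := ⟨by simp⟩

/-- `[0,1)` is partitioned into the intervals `[L t, R t)`, where `t` runs through `[0,1)`. -/
structure IsPartition (L R : ℝ → ℝ) : Prop where
  measurable_left : Measurable L
  measurable_right : Measurable R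
  nonneg : ∀ t, 0 ≤ L t
  le_one : ∀ t, R t ≤ 1
  mem : ∀ t ∈ Ico (0 : ℝ) 1, t ∈ Ico (L t) (R t)
  const : ∀ t ∈ Ico (0 : ℝ) 1, ∀ s ∈ Ico (L t) (R t), L s = L t ∧ R s = R t

namespace IsPartition

variable {L R : ℝ → ℝ}

/-- The length of the interval that contains `t`. -/
def length (_ : IsPartition L R) (t : ℝ) : ℝ≥0∞ := ENNReal.ofReal (R t - L t)

lemma measurable_length (h : IsPartition L R) : Measurable h.length :=
  (h.measurable_right.sub h.measurable_left).ennreal_ofReal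

lemma length_ne_zero (h : IsPartition L R) {t : ℝ} (ht : t ∈ Ico (0 : ℝ) 1) : h.length t ≠ 0 := by
  have := h.mem t ht
  simp only [length, ne_eq, ENNReal.ofReal_eq_zero, not_le]
  linarith [this.1, this.2]

lemma length_ne_top (h : IsPartition L R) (t : ℝ) : h.length t ≠ ⊤ := ENNReal.ofReal_ne_top

lemma subset (h : IsPartition L R) (t : ℝ) : Ico (L t) (R t) ⊆ Ico 0 1 :=
  Ico_subset_Ico (h.nonneg t) (h.le_one t)

lemma measurableSet_graph (h : IsPartition L R) :
    MeasurableSet {z : ℝ × ℝ | z.2 ∈ Ico (L z.1) (R z.1)} :=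
  (measurableSet_le (h.measurable_left.comp measurable_fst) measurable_snd).inter
    (measurableSet_lt measurable_snd (h.measurable_right.comp measurable_fst))

lemma setLIntegral_eq (_ : IsPartition L R) (u : ℝ → ℝ≥0∞) (t : ℝ) :
    ∫⁻ s in Ico (L t) (R t), u s
      = ∫⁻ s, {z : ℝ × ℝ | z.2 ∈ Ico (L z.1) (R z.1)}.indicator (fun z => u z.2) (t, s) := by
  rw [← lintegral_indicator measurableSet_Ico]
  rfl

lemma measurable_setLIntegral (h : IsPartition L R) {u : ℝ → ℝ≥0∞} (hu : Measurable u) :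
    Measurable fun t => ∫⁻ s in Ico (L t) (R t), u s := by
  simp_rw [h.setLIntegral_eq u]
  exact ((hu.comp measurable_snd).indicator h.measurableSet_graph).lintegral_prod_right'

/-- Averaging over the intervals of the partition does not increase the integral. -/
lemma lintegral_average_le (h : IsPartition L R) {u : ℝ → ℝ≥0∞} (hu : Measurable u) :
    ∫⁻ t in Ico (0 : ℝ) 1, (∫⁻ s in Ico (L t) (R t), u s) * (h.length t)⁻¹
      ≤ ∫⁻ s in Ico (0 : ℝ) 1, u s := by
  set G : Set (ℝ × ℝ) := {z | z.2 ∈ Ico (L z.1) (R z.1)}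
  have hGm : Measurable (G.indicator fun z => u z.2) :=
    (hu.comp measurable_snd).indicator h.measurableSet_graph
  calc ∫⁻ t in Ico (0 : ℝ) 1, (∫⁻ s in Ico (L t) (R t), u s) * (h.length t)⁻¹
      = ∫⁻ t in Ico (0 : ℝ) 1, ∫⁻ s, G.indicator (fun z => u z.2) (t, s) * (h.length t)⁻¹ := by
        refine lintegral_congr fun t => ?_
        rw [h.setLIntegral_eq]
        exact (lintegral_mul_const _ (hGm.comp measurable_prodMk_left)).symm
    _ = ∫⁻ s, ∫⁻ t in Ico (0 : ℝ) 1, G.indicator (fun z => u z.2) (t, s) * (h.length t)⁻¹ := by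
        apply lintegral_lintegral_swap
        exact (hGm.mul (h.measurable_length.inv.comp measurable_fst)).aemeasurable
    _ ≤ ∫⁻ s, (Ico (0 : ℝ) 1).indicator u s := by
        refine lintegral_mono fun s => ?_
        by_cases hs : s ∈ Ico (0 : ℝ) 1
        · rw [indicator_of_mem hs]
          -- For fixed `s`, the points `t` whose interval contains `s` lie in the interval of `s`,
          -- which has the same length; the length cancels.
          calc ∫⁻ t in Ico (0 : ℝ) 1, G.indicator (fun z => u z.2) (t, s) * (h.length t)⁻¹
              ≤ ∫⁻ t in Ico (0 : ℝ) 1,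
                  (Ico (L s) (R s)).indicator (fun _ => u s * (h.length s)⁻¹) t := by
                refine setLIntegral_mono' measurableSet_Ico fun t ht => ?_
                by_cases hts : s ∈ Ico (L t) (R t)
                · have hst := h.const t ht s hts
                  have : t ∈ Ico (L s) (R s) := by
                    rw [hst.1, hst.2]
                    exact h.mem t ht
                  rw [indicator_of_mem this, indicator_of_mem (by exact hts)]
                  simp [length, hst.1, hst.2]
                · rw [indicator_of_notMem (by exact hts)]
                  simp
            _ ≤ ∫⁻ t, (Ico (L s) (R s)).indicator (fun _ => u s * (h.length s)⁻¹) t :=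
                setLIntegral_le_lintegral _ _
            _ = u s := by
                rw [lintegral_indicator measurableSet_Ico, setLIntegral_const, Real.volume_Ico,
                  mul_assoc]
                change u s * ((h.length s)⁻¹ * h.length s) = u s
                rw [ENNReal.inv_mul_cancel (h.length_ne_zero hs) (h.length_ne_top s), mul_one]
        · rw [indicator_of_notMem hs]
          refine le_of_eq ?_
          rw [lintegral_eq_zero_iff' (by
            exact ((hGm.comp measurable_prodMk_right).mul h.measurable_length.inv).aemeasurable)]
          refine Eventually.of_forall fun t => ?_
          have : (t, s) ∉ G := fun hts => hs (h.subset t hts)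
          simp [this]
    _ = ∫⁻ s in Ico (0 : ℝ) 1, u s := lintegral_indicator measurableSet_Ico _

lemma setLIntegral_enorm_le (h : IsPartition L R) {p : ℝ≥0∞} (hp : 1 ≤ p) {D : ℝ → ℝ}
    (hD : Measurable D) (t : ℝ) :
    ∫⁻ s in Ico (L t) (R t), ‖D s‖ₑ
      ≤ eLpNorm D p (volume.restrict (Ico (L t) (R t))) * h.length t ^ (1 - p⁻¹.toReal) := by
  have := eLpNorm_le_eLpNorm_mul_rpow_measure_univ hp
    (hD.aestronglyMeasurable (μ := volume.restrict (Ico (L t) (R t))))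
  rw [eLpNorm_one_eq_lintegral_enorm] at this
  simpa [length, ENNReal.toReal_inv] using this

lemma one_sub_inv_toReal_nonneg {p : ℝ≥0∞} (hp : 1 ≤ p) : 0 ≤ 1 - p⁻¹.toReal := by
  have : p⁻¹ ≤ 1 := ENNReal.inv_le_one.2 hp
  have := ENNReal.toReal_mono ENNReal.one_ne_top this
  simp only [ENNReal.toReal_one] at this
  linarith

lemma setLIntegral_enorm_le_rpow (h : IsPartition L R) {p : ℝ≥0∞} (hp : 1 ≤ p) (hp' : p ≠ ⊤)
    {D : ℝ → ℝ} (hD : Measurable D) (t : ℝ) :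
    ∫⁻ s in Ico (L t) (R t), ‖D s‖ₑ
      ≤ (∫⁻ s in Ico (L t) (R t), ‖D s‖ₑ ^ p.toReal) ^ (1 / p.toReal)
        * h.length t ^ (1 - 1 / p.toReal) := by
  have := h.setLIntegral_enorm_le hp hD t
  rwa [eLpNorm_eq_lintegral_rpow_enorm_toReal (by positivity) hp', ENNReal.toReal_inv,
    ← one_div] at this

lemma lintegral_rpow_le {p : ℝ≥0∞} (hp : 1 ≤ p) (hp' : p ≠ ⊤) {D : ℝ → ℝ} {M : ℝ≥0∞}
    (hM : eLpNorm D p lebesgue01 ≤ M) :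
    ∫⁻ s in Ico (0 : ℝ) 1, ‖D s‖ₑ ^ p.toReal ≤ M ^ p.toReal := by
  have hp0 : 0 < p.toReal := ENNReal.toReal_pos (by positivity) hp'
  rw [lebesgue01_eq_restrict_Ico, eLpNorm_eq_lintegral_rpow_enorm_toReal (by positivity) hp',
    one_div, ENNReal.rpow_inv_le_iff hp0] at hM
  exact hM

/-- The case `p ≤ q`: the error is controlled by the longest interval of the partition. -/
lemma eLpNorm_le_of_length_le (h : IsPartition L R) {p q : ℝ≥0∞} (hp : 1 ≤ p) (hpq : p ≤ q)
    {D H : ℝ → ℝ} (hD : Measurable D)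
    (hH : ∀ t ∈ Ico (0 : ℝ) 1, ‖H t‖ₑ ≤ ∫⁻ s in Ico (L t) (R t), ‖D s‖ₑ)
    {δ M : ℝ≥0∞} (hδ : ∀ t ∈ Ico (0 : ℝ) 1, h.length t ≤ δ) (hM : eLpNorm D p lebesgue01 ≤ M) :
    eLpNorm H q lebesgue01 ≤ δ ^ (1 - p⁻¹.toReal + q⁻¹.toReal) * M := by
  rcases eq_or_ne q ⊤ with rfl | hq
  · rw [eLpNorm_exponent_top]
    refine eLpNormEssSup_le_of_ae_enorm_bound ?_
    rw [lebesgue01_eq_restrict_Ico] at hM ⊢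
    filter_upwards [ae_restrict_mem measurableSet_Ico] with t ht
    refine (hH t ht).trans ((h.setLIntegral_enorm_le hp hD t).trans ?_)
    rw [mul_comm]
    gcongr
    · simpa using ENNReal.rpow_le_rpow (hδ t ht) (one_sub_inv_toReal_nonneg hp)
    · exact (eLpNorm_mono_measure D (Measure.restrict_mono (h.subset t) le_rfl)).trans hM
  · have hp' : p ≠ ⊤ := ne_top_of_le_ne_top hq hpq
    have hP : 0 < p.toReal := ENNReal.toReal_pos (by positivity) hp'
    have hPQ : p.toReal ≤ q.toReal := ENNReal.toReal_mono hq hpq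
    have hP1 : 1 ≤ p.toReal := by simpa using ENNReal.toReal_mono hp' hp
    have hMP := lintegral_rpow_le hp hp' hM
    have hq0 : q ≠ 0 := by
      have := hp.trans hpq
      positivity
    rw [lebesgue01_eq_restrict_Ico, eLpNorm_eq_lintegral_rpow_enorm_toReal hq0 hq,
      one_div, ENNReal.toReal_inv, ENNReal.toReal_inv]
    set P := p.toReal
    set Q := q.toReal
    have hQ : 0 < Q := hP.trans_le hPQ
    have hQP : 1 ≤ Q / P := (one_le_div hP).2 hPQ
    have hQPQ : Q / P ≤ Q := div_le_self hQ.le hP1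
    rw [ENNReal.rpow_inv_le_iff hQ, ENNReal.mul_rpow_of_nonneg _ _ hQ.le, ← ENNReal.rpow_mul]
    have he : (1 - P⁻¹ + Q⁻¹) * Q = Q - Q / P + 1 := by field_simp
    rw [he]
    set a : ℝ → ℝ≥0∞ := fun t => ∫⁻ s in Ico (L t) (R t), ‖D s‖ₑ ^ P with ha
    have haM : ∀ t, a t ≤ M ^ P := fun t =>
      (lintegral_mono_set (h.subset t)).trans hMP
    -- Because `Q/P ≥ 1`, one factor `a t` can be split off `(a t)^(Q/P)` and the rest bounded by
    -- the global norm. Inserting `length * length⁻¹` leaves the average `a t / length`, whose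
    -- integral is controlled by `lintegral_average_le`.
    have hmain : ∀ t ∈ Ico (0 : ℝ) 1, ‖H t‖ₑ ^ Q
        ≤ δ ^ (Q - Q / P + 1) * M ^ (Q - P) * (a t * (h.length t)⁻¹) := by
      intro t ht
      have hl0 := h.length_ne_zero ht
      have hlt := h.length_ne_top t
      have h1 := (hH t ht).trans (h.setLIntegral_enorm_le_rpow hp hp' hD t)
      calc ‖H t‖ₑ ^ Q ≤ (a t ^ (1 / P) * h.length t ^ (1 - 1 / P)) ^ Q := by gcongr
        _ = a t ^ (Q / P) * h.length t ^ (Q - Q / P) := by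
          rw [ENNReal.mul_rpow_of_nonneg _ _ hQ.le, ← ENNReal.rpow_mul, ← ENNReal.rpow_mul]
          congr 2 <;> field_simp
        _ = (a t * a t ^ (Q / P - 1)) * (h.length t ^ (Q - Q / P + 1) * (h.length t)⁻¹) := by
          congr 1
          · conv_rhs => rw [← ENNReal.rpow_one (a t), ← ENNReal.rpow_mul, one_mul]
            rw [← ENNReal.rpow_add_of_nonneg _ _ zero_le_one (by linarith)]
            congr 1
            ring
          · rw [ENNReal.rpow_add _ _ hl0 hlt, ENNReal.rpow_one, mul_assoc,
              ENNReal.mul_inv_cancel hl0 hlt, mul_one]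
        _ ≤ (a t * (M ^ P) ^ (Q / P - 1)) * (δ ^ (Q - Q / P + 1) * (h.length t)⁻¹) := by
          gcongr
          · exact haM t
          · exact hδ t ht
        _ = _ := by
          rw [← ENNReal.rpow_mul]
          have : P * (Q / P - 1) = Q - P := by field_simp
          rw [this]
          ring
    calc ∫⁻ t in Ico (0 : ℝ) 1, ‖H t‖ₑ ^ Q
        ≤ ∫⁻ t in Ico (0 : ℝ) 1, δ ^ (Q - Q / P + 1) * M ^ (Q - P) * (a t * (h.length t)⁻¹) :=
          setLIntegral_mono' measurableSet_Ico hmain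
      _ = δ ^ (Q - Q / P + 1) * M ^ (Q - P)
            * ∫⁻ t in Ico (0 : ℝ) 1, a t * (h.length t)⁻¹ := by
          rw [lintegral_const_mul]
          exact (h.measurable_setLIntegral (hD.enorm.pow_const P)).mul h.measurable_length.inv
      _ ≤ δ ^ (Q - Q / P + 1) * M ^ (Q - P) * M ^ P := by
          gcongr
          exact (h.lintegral_average_le (hD.enorm.pow_const P)).trans hMP
      _ = δ ^ (Q - Q / P + 1) * M ^ Q := by
          rw [mul_assoc, ← ENNReal.rpow_add_of_nonneg _ _ (by linarith) hP.le, sub_add_cancel]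

/-- The case `q < p`: the error is controlled by a moment of the lengths of the intervals. -/
lemma eLpNorm_le_lintegral_length_rpow (h : IsPartition L R) {p q : ℝ≥0∞} (hq : 1 ≤ q)
    (hqp : q < p) (hp' : p ≠ ⊤) {D H : ℝ → ℝ} (hD : Measurable D)
    (hH : ∀ t ∈ Ico (0 : ℝ) 1, ‖H t‖ₑ ≤ ∫⁻ s in Ico (L t) (R t), ‖D s‖ₑ)
    {M : ℝ≥0∞} (hM : eLpNorm D p lebesgue01 ≤ M) {α : ℝ}
    (hα : α = (1 / q.toReal - 1 / p.toReal)⁻¹) :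
    eLpNorm H q lebesgue01 ≤ (∫⁻ t in Ico (0 : ℝ) 1, h.length t ^ α) ^ (1 / α) * M := by
  have hp : 1 ≤ p := hq.trans hqp.le
  have hMP := lintegral_rpow_le hp hp' hM
  have hq' : q ≠ ⊤ := hqp.ne_top
  have hQ : 0 < q.toReal := ENNReal.toReal_pos (by positivity) hq'
  have hQP : q.toReal < p.toReal := (ENNReal.toReal_lt_toReal hq' hp').2 hqp
  rw [lebesgue01_eq_restrict_Ico, eLpNorm_eq_lintegral_rpow_enorm_toReal (by positivity) hq',
    one_div]
  set P := p.toReal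
  set Q := q.toReal
  have hP : 0 < P := hQ.trans hQP
  have hα0 : 0 < α := by
    rw [hα, inv_pos, sub_pos]
    exact one_div_lt_one_div_of_lt hQ hQP
  have hαinv : α⁻¹ = 1 / Q - 1 / P := by rw [hα, inv_inv]
  -- The choice of `α` is exactly `Q/α + Q/P = 1`, so Hölder separates the lengths from the averages
  -- of `‖D‖^P`.
  have hconj : (α / Q).HolderConjugate (P / Q) := by
    rw [Real.holderConjugate_comm, Real.holderConjugate_iff]
    refine ⟨(one_lt_div hQ).2 hQP, ?_⟩
    rw [inv_div, inv_div, div_eq_mul_inv Q α, hαinv]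
    field_simp
    ring
  set a : ℝ → ℝ≥0∞ := fun t => ∫⁻ s in Ico (L t) (R t), ‖D s‖ₑ ^ P with ha
  have ham : Measurable a := h.measurable_setLIntegral (hD.enorm.pow_const P)
  have hmain : ∀ t ∈ Ico (0 : ℝ) 1,
      ‖H t‖ₑ ^ Q ≤ h.length t ^ Q * (a t * (h.length t)⁻¹) ^ (Q / P) := by
    intro t ht
    have hl0 := h.length_ne_zero ht
    have hlt := h.length_ne_top t
    have h1 := (hH t ht).trans (h.setLIntegral_enorm_le_rpow hp hp' hD t)
    calc ‖H t‖ₑ ^ Q ≤ (a t ^ (1 / P) * h.length t ^ (1 - 1 / P)) ^ Q := by gcongr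
      _ = a t ^ (Q / P) * h.length t ^ (Q - Q / P) := by
        rw [ENNReal.mul_rpow_of_nonneg _ _ hQ.le, ← ENNReal.rpow_mul, ← ENNReal.rpow_mul]
        congr 2 <;> field_simp
      _ = _ := by
        rw [ENNReal.mul_rpow_of_nonneg _ _ (by positivity), ENNReal.inv_rpow,
          ENNReal.rpow_sub _ _ hl0 hlt, ENNReal.div_eq_inv_mul]
        ring
  have hbm : Measurable fun t => (a t * (h.length t)⁻¹) ^ (Q / P) :=
    (ham.mul h.measurable_length.inv).pow_const _
  have hlm : Measurable fun t => h.length t ^ Q := h.measurable_length.pow_const _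
  rw [ENNReal.rpow_inv_le_iff hQ, ENNReal.mul_rpow_of_nonneg _ _ hQ.le, ← ENNReal.rpow_mul]
  calc ∫⁻ t in Ico (0 : ℝ) 1, ‖H t‖ₑ ^ Q
      ≤ ∫⁻ t in Ico (0 : ℝ) 1,
          ((fun t => h.length t ^ Q) * fun t => (a t * (h.length t)⁻¹) ^ (Q / P)) t :=
        setLIntegral_mono' measurableSet_Ico hmain
    _ ≤ (∫⁻ t in Ico (0 : ℝ) 1, (h.length t ^ Q) ^ (α / Q)) ^ (1 / (α / Q)) *
          (∫⁻ t in Ico (0 : ℝ) 1, ((a t * (h.length t)⁻¹) ^ (Q / P)) ^ (P / Q)) ^ (1 / (P / Q)) :=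
        ENNReal.lintegral_mul_le_Lp_mul_Lq _ hconj hlm.aemeasurable hbm.aemeasurable
    _ = (∫⁻ t in Ico (0 : ℝ) 1, h.length t ^ α) ^ (1 / α * Q) *
          (∫⁻ t in Ico (0 : ℝ) 1, a t * (h.length t)⁻¹) ^ (Q / P) := by
        have e1 : Q * (α / Q) = α := by field_simp
        have e2 : Q / P * (P / Q) = 1 := by field_simp
        have e3 : 1 / (α / Q) = 1 / α * Q := by field_simp
        have e4 : 1 / (P / Q) = Q / P := by field_simp
        simp_rw [← ENNReal.rpow_mul, e1, e2, e3, e4, ENNReal.rpow_one]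
    _ ≤ (∫⁻ t in Ico (0 : ℝ) 1, h.length t ^ α) ^ (1 / α * Q) * (M ^ P) ^ (Q / P) := by
        gcongr
        exact (h.lintegral_average_le (hD.enorm.pow_const P)).trans hMP
    _ = _ := by
        rw [← ENNReal.rpow_mul]
        congr 2
        field_simp

end IsPartition

/-! ### Upper bounds for the radius in terms of the gaps between nodes. -/

/-- The algorithm returns any ball element with the observed data. The value `0` is taken only for
data that no ball element produces. -/
lemma radius_le_of_forall {p q : ℝ≥0∞} {n : ℕ} {x : Fin n → unitInterval} {B : ℝ≥0∞}
    (hB : ∀ f ∈ unitBall p, ∀ g ∈ unitBall p, info x f = info x g →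
      eLpNorm (fun t => f t - g t) q lebesgue01 ≤ B) : radius p q x ≤ B := by
  classical
  have hmem : ∀ f ∈ unitBall p, MemLp f q lebesgue01 := by
    intro f hf
    have hc : ContinuousOn f (Icc 0 1) := by
      simpa [uIcc_of_le (zero_le_one (α := ℝ))] using hf.1.1.continuousOn
    obtain ⟨C, hC⟩ := isCompact_Icc.exists_bound_of_continuousOn hc
    refine MemLp.of_bound (hc.aestronglyMeasurable measurableSet_Icc) C ?_
    filter_upwards [ae_restrict_mem measurableSet_Icc] with t ht using hC t ht
  refine iInf_le_of_le (fun y => if h : ∃ g ∈ unitBall p, info x g = y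
    then (hmem h.choose h.choose_spec.1).toLp else 0) ?_
  refine iSup₂_le fun f hf => ?_
  have h : ∃ g ∈ unitBall p, info x g = info x f := ⟨f, hf, rfl⟩
  simp only [dif_pos h]
  set g := h.choose with hg
  have hgball : g ∈ unitBall p := h.choose_spec.1
  have hgf : info x g = info x f := h.choose_spec.2
  refine le_trans (le_of_eq (eLpNorm_congr_ae ?_)) (hB f hf g hgball hgf.symm)
  filter_upwards [(hmem g hgball).coeFn_toLp] with t ht
  rw [ht]

lemma eLpNorm_deriv_le_one {p : ℝ≥0∞} (hp : 1 ≤ p) {f : ℝ → ℝ} (hf : f ∈ unitBall p) :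
    eLpNorm (deriv f) p lebesgue01 ≤ 1 := by
  have h := hf.2
  unfold sobolevNorm at h
  split_ifs at h with hp'
  · rw [hp']
    exact (le_max_right _ _).trans h
  · have hp0 : 0 < p.toReal := ENNReal.toReal_pos (by positivity) hp'
    rw [one_div, ENNReal.rpow_inv_le_iff hp0, ENNReal.one_rpow] at h
    have := le_add_self.trans h
    rwa [← ENNReal.le_rpow_inv_iff hp0, ENNReal.one_rpow] at this

section Gaps

variable {n : ℕ}

/-- The largest node that is at most `t` (or `0`). -/
noncomputable def leftNode (x : Fin n → unitInterval) (t : ℝ) : unitInterval :=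
  Finset.univ.sup fun i => if (x i : ℝ) ≤ t then x i else ⊥

/-- The smallest node that is larger than `t` (or `1`). -/
noncomputable def rightNode (x : Fin n → unitInterval) (t : ℝ) : unitInterval :=
  Finset.univ.inf fun i => if t < x i then x i else ⊤

lemma le_leftNode {x : Fin n → unitInterval} {t : ℝ} {i : Fin n} (h : (x i : ℝ) ≤ t) :
    x i ≤ leftNode x t := by
  have := Finset.le_sup (f := fun i => if (x i : ℝ) ≤ t then x i else ⊥) (Finset.mem_univ i)
  rwa [if_pos h] at this

lemma rightNode_le {x : Fin n → unitInterval} {t : ℝ} {i : Fin n} (h : t < x i) :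
    rightNode x t ≤ x i := by
  have := Finset.inf_le (f := fun i => if t < x i then x i else ⊤) (Finset.mem_univ i)
  rwa [if_pos h] at this

lemma leftNode_le (x : Fin n → unitInterval) {t : ℝ} (ht : 0 ≤ t) : (leftNode x t : ℝ) ≤ t := by
  by_cases h1 : t ≤ 1
  · have : leftNode x t ≤ ⟨t, ht, h1⟩ := by
      refine Finset.sup_le fun i _ => ?_
      split_ifs with h
      · exact h
      · exact bot_le
    exact this
  · exact (leftNode x t).2.2.trans (not_le.1 h1).le

lemma lt_rightNode (x : Fin n → unitInterval) {t : ℝ} (ht : t ∈ Ico (0 : ℝ) 1) :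
    t < rightNode x t := by
  have : (⟨t, ht.1, ht.2.le⟩ : unitInterval) < rightNode x t := by
    refine (Finset.lt_inf_iff (lt_top_iff_ne_top.2 ?_)).2 fun i _ => ?_
    · intro h
      exact ht.2.ne (congrArg Subtype.val h)
    · split_ifs with h
      · exact h
      · refine lt_top_iff_ne_top.2 fun h => ht.2.ne (congrArg Subtype.val h)
  exact this

lemma measurable_leftNode_prod :
    Measurable fun z : (Fin n → unitInterval) × ℝ => (leftNode z.1 z.2 : ℝ) := by
  refine measurable_subtype_coe.comp ?_
  have : (fun z : (Fin n → unitInterval) × ℝ => leftNode z.1 z.2) =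
      Finset.univ.sup fun (i : Fin n) (z : (Fin n → unitInterval) × ℝ) =>
        if (z.1 i : ℝ) ≤ z.2 then z.1 i else ⊥ := by
    ext z
    simp [leftNode, Finset.sup_apply]
  rw [this]
  refine Finset.sup_induction (p := Measurable) measurable_const (fun _ h _ h' => h.sup h') ?_
  intro i _
  exact Measurable.ite (measurableSet_le (by fun_prop) (by fun_prop)) (by fun_prop) (by fun_prop)

lemma measurable_rightNode_prod :
    Measurable fun z : (Fin n → unitInterval) × ℝ => (rightNode z.1 z.2 : ℝ) := by
  refine measurable_subtype_coe.comp ?_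
  have : (fun z : (Fin n → unitInterval) × ℝ => rightNode z.1 z.2) =
      Finset.univ.inf fun (i : Fin n) (z : (Fin n → unitInterval) × ℝ) =>
        if z.2 < (z.1 i : ℝ) then z.1 i else ⊤ := by
    ext z
    simp [rightNode, Finset.inf_apply]
  rw [this]
  refine Finset.inf_induction (p := Measurable) measurable_const (fun _ h _ h' => h.inf h') ?_
  intro i _
  exact Measurable.ite (measurableSet_lt (by fun_prop) (by fun_prop)) (by fun_prop) (by fun_prop)

lemma isPartition_nodes (x : Fin n → unitInterval) :
    IsPartition (fun t => leftNode x t) (fun t => rightNode x t) where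
  measurable_left := measurable_leftNode_prod.comp measurable_prodMk_left
  measurable_right := measurable_rightNode_prod.comp measurable_prodMk_left
  nonneg t := (leftNode x t).2.1
  le_one t := (rightNode x t).2.2
  mem t ht := ⟨leftNode_le x ht.1, lt_rightNode x ht⟩
  const t ht s hs := by
    have key : ∀ i, (x i : ℝ) ≤ s ↔ (x i : ℝ) ≤ t := by
      intro i
      constructor
      · intro h
        by_contra hlt
        have : (rightNode x t : ℝ) ≤ x i := rightNode_le (not_le.1 hlt)
        have := hs.2
        linarith
      · intro h
        have : (x i : ℝ) ≤ leftNode x t := le_leftNode h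
        exact this.trans hs.1
    have key' : ∀ i, s < x i ↔ t < x i := fun i => by
      rw [← not_le, ← not_le, key i]
    simp only [leftNode, rightNode, key, key', and_self]

/-- The defaults `0` and `1` are not nodes in general, but they cannot occur at both ends of a gap
unless one of them is a node. One genuine node is enough to start the integration of `f' - g'`. -/
lemma exists_node_mem (hn : n ≠ 0) (x : Fin n → unitInterval) (t : ℝ) :
    ∃ i, x i = leftNode x t ∨ x i = rightNode x t := by
  have hne : (Finset.univ : Finset (Fin n)).Nonempty := by
    have : NeZero n := ⟨hn⟩
    exact Finset.univ_nonempty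
  obtain ⟨i, -, hi⟩ := Finset.exists_mem_eq_sup Finset.univ hne
    fun i => if (x i : ℝ) ≤ t then x i else ⊥
  by_cases h : (x i : ℝ) ≤ t
  · exact ⟨i, Or.inl (by rw [leftNode, hi, if_pos h])⟩
  obtain ⟨j, -, hj⟩ := Finset.exists_mem_eq_inf Finset.univ hne
    fun i => if t < x i then x i else ⊤
  by_cases h' : t < x j
  · exact ⟨j, Or.inr (by rw [rightNode, hj, if_pos h'])⟩
  · have h1 : rightNode x t = ⊤ := by rw [rightNode, hj, if_neg h']
    have h2 := rightNode_le (not_le.1 h)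
    rw [h1, top_le_iff] at h2
    exact ⟨i, Or.inr (by rw [h1, h2])⟩

lemma enorm_sub_le_setLIntegral {p : ℝ≥0∞} (hn : n ≠ 0) {x : Fin n → unitInterval}
    {f g : ℝ → ℝ} (hf : f ∈ unitBall p) (hg : g ∈ unitBall p) (hfg : info x f = info x g)
    {t : ℝ} (ht : t ∈ Ico (0 : ℝ) 1) :
    ‖f t - g t‖ₑ
      ≤ ∫⁻ s in Ico (leftNode x t : ℝ) (rightNode x t), ‖deriv f s - deriv g s‖ₑ := by
  obtain ⟨i, hi⟩ := exists_node_mem hn x t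
  have hmem := (isPartition_nodes x).mem t ht
  have hxi : (x i : ℝ) ∈ Icc (leftNode x t : ℝ) (rightNode x t) := by
    have hle := hmem.1.trans hmem.2.le
    rcases hi with hi | hi <;> rw [hi]
    · exact left_mem_Icc.2 hle
    · exact right_mem_Icc.2 hle
  have hfgi : f (x i) = g (x i) := congrFun hfg i
  have hsub : uIcc (x i : ℝ) t ⊆ uIcc 0 1 := by
    rw [uIcc_of_le (zero_le_one (α := ℝ))]
    exact (convex_Icc (0 : ℝ) 1).ordConnected.uIcc_subset (x i).2 ⟨ht.1, ht.2.le⟩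
  have hf1 := (hf.1.1.mono hsub)
  have hg1 := (hg.1.1.mono hsub)
  have heq : f t - g t = ∫ s in (x i : ℝ)..t, (deriv f s - deriv g s) := by
    rw [intervalIntegral.integral_sub hf1.intervalIntegrable_deriv hg1.intervalIntegrable_deriv,
      hf1.integral_deriv_eq_sub, hg1.integral_deriv_eq_sub, hfgi]
    ring
  have hsub' : uIoc (x i : ℝ) t ⊆ Icc (leftNode x t : ℝ) (rightNode x t) :=
    uIoc_subset_uIcc.trans
      ((convex_Icc _ _).ordConnected.uIcc_subset hxi ⟨hmem.1, hmem.2.le⟩)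
  calc ‖f t - g t‖ₑ = ‖∫ s in uIoc (x i : ℝ) t, (deriv f s - deriv g s)‖ₑ := by
        rw [heq, ← ofReal_norm, ← ofReal_norm, intervalIntegral.norm_intervalIntegral_eq]
    _ ≤ ∫⁻ s in uIoc (x i : ℝ) t, ‖deriv f s - deriv g s‖ₑ := enorm_integral_le_lintegral_enorm _
    _ ≤ ∫⁻ s in Icc (leftNode x t : ℝ) (rightNode x t), ‖deriv f s - deriv g s‖ₑ :=
        lintegral_mono_set hsub'
    _ = _ := by rw [Measure.restrict_congr_set Ico_ae_eq_Icc]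

lemma eLpNorm_deriv_sub_le {p : ℝ≥0∞} (hp : 1 ≤ p) {f g : ℝ → ℝ} (hf : f ∈ unitBall p)
    (hg : g ∈ unitBall p) : eLpNorm (fun s => deriv f s - deriv g s) p lebesgue01 ≤ 2 :=
  (eLpNorm_sub_le (measurable_deriv f).aestronglyMeasurable
    (measurable_deriv g).aestronglyMeasurable hp).trans <|
    (add_le_add (eLpNorm_deriv_le_one hp hf) (eLpNorm_deriv_le_one hp hg)).trans
      (by norm_num)

lemma radius_le_of_length_le {p q : ℝ≥0∞} (hp : 1 ≤ p) (hpq : p ≤ q) (hn : n ≠ 0)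
    (x : Fin n → unitInterval) {δ : ℝ≥0∞}
    (hδ : ∀ t ∈ Ico (0 : ℝ) 1, (isPartition_nodes x).length t ≤ δ) :
    radius p q x ≤ δ ^ (1 - p⁻¹.toReal + q⁻¹.toReal) * 2 := by
  refine radius_le_of_forall fun f hf g hg hfg => ?_
  refine (isPartition_nodes x).eLpNorm_le_of_length_le hp hpq
    ((measurable_deriv f).sub (measurable_deriv g)) (fun t ht => ?_) hδ
    (eLpNorm_deriv_sub_le hp hf hg)
  exact enorm_sub_le_setLIntegral hn hf hg hfg ht

/-- The finite exponent `r` between `q` and `p` makes the argument cover `p = ∞`; on a probability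
space the `L_r` norm is at most the `L_p` norm. -/
lemma radius_le_lintegral_length {p q r : ℝ≥0∞} (hq : 1 ≤ q) (hqr : q < r) (hr : r ≠ ⊤)
    (hrp : r ≤ p) (hn : n ≠ 0) (x : Fin n → unitInterval) {α : ℝ}
    (hα : α = (1 / q.toReal - 1 / r.toReal)⁻¹) :
    radius p q x ≤
      (∫⁻ t in Ico (0 : ℝ) 1, (isPartition_nodes x).length t ^ α) ^ (1 / α) * 2 := by
  have hp : 1 ≤ p := hq.trans (hqr.le.trans hrp)
  refine radius_le_of_forall fun f hf g hg hfg => ?_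
  have hm : Measurable fun s => deriv f s - deriv g s :=
    (measurable_deriv f).sub (measurable_deriv g)
  refine (isPartition_nodes x).eLpNorm_le_lintegral_length_rpow hq hqr hr hm (fun t ht => ?_)
    ((eLpNorm_le_eLpNorm_of_exponent_le hrp hm.aestronglyMeasurable).trans
      (eLpNorm_deriv_sub_le hp hf hg)) hα
  exact enorm_sub_le_setLIntegral hn hf hg hfg ht

/-- If every point of `[0,1]` is within `δ` of a node, then the gaps have length at most `2δ`. -/
lemma length_le_of_cover {x : Fin n → unitInterval} {δ : ℝ}
    (hδ : ∀ t ∈ Icc (0 : ℝ) 1, ∃ i, |(x i : ℝ) - t| ≤ δ) (t : ℝ) :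
    (isPartition_nodes x).length t ≤ ENNReal.ofReal (2 * δ) := by
  refine ENNReal.ofReal_le_ofReal ?_
  by_contra! hlt
  have hL := (leftNode x t).2
  have hR := (rightNode x t).2
  obtain ⟨i, hi⟩ := hδ (((leftNode x t : ℝ) + rightNode x t) / 2)
    ⟨by linarith [hL.1, hR.1], by linarith [hL.2, hR.2]⟩
  rw [abs_le] at hi
  rcases le_or_gt (x i : ℝ) t with h | h
  · have : (x i : ℝ) ≤ leftNode x t := le_leftNode h
    linarith
  · have : (rightNode x t : ℝ) ≤ x i := rightNode_le h
    linarith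

lemma radius_le_of_cover {p q : ℝ≥0∞} (hp : 1 ≤ p) (hpq : p ≤ q) (hn : n ≠ 0)
    {x : Fin n → unitInterval} {δ : ℝ} (hδ : ∀ t ∈ Icc (0 : ℝ) 1, ∃ i, |(x i : ℝ) - t| ≤ δ) :
    radius p q x ≤ ENNReal.ofReal (2 * δ) ^ (1 - p⁻¹.toReal + q⁻¹.toReal) * 2 :=
  radius_le_of_length_le hp hpq hn x fun t _ => length_le_of_cover hδ t

/-- The radius is at most `2`. -/
lemma radius_le_two {p q : ℝ≥0∞} (hp : 1 ≤ p) (hpq : p ≤ q) (hn : n ≠ 0)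
    (x : Fin n → unitInterval) : radius p q x ≤ 2 := by
  have := radius_le_of_length_le hp hpq hn x (δ := 1) fun t _ => by
    refine (ENNReal.ofReal_le_ofReal ?_).trans_eq ENNReal.ofReal_one
    linarith [(leftNode x t).2.1, (rightNode x t).2.2]
  simpa using this

end Gaps

/-! ### Random nodes: moments of the gap lengths. -/

section Probability

variable {n : ℕ}

/-- The configurations without a node in `A`. -/
def avoid (n : ℕ) (A : Set ℝ) : Set (Fin n → unitInterval) := {x | ∀ i, (x i : ℝ) ∉ A}

lemma measurableSet_avoid {A : Set ℝ} (hA : MeasurableSet A) : MeasurableSet (avoid n A) := by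
  have : avoid n A = ⋂ i, (fun x : Fin n → unitInterval => (x i : ℝ)) ⁻¹' Aᶜ := by
    ext x
    simp [avoid]
  rw [this]
  exact MeasurableSet.iInter fun i =>
    (measurable_subtype_coe.comp (measurable_pi_apply i)) hA.compl

lemma avoid_inter (A B : Set ℝ) : avoid n A ∩ avoid n B = avoid n (A ∪ B) := by
  ext x
  simp [avoid, forall_and]

lemma volume_avoid {A : Set ℝ} (hA : MeasurableSet A) :
    volume (avoid n A) = (1 - lebesgue01 A) ^ n := by
  have h1 : avoid n A = Set.univ.pi fun _ => (((↑) : unitInterval → ℝ) ⁻¹' A)ᶜ := by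
    ext x
    simp [avoid]
  have h2 : volume (((↑) : unitInterval → ℝ) ⁻¹' A) = lebesgue01 A :=
    unitInterval.measurePreserving_coe.measure_preimage hA.nullMeasurableSet
  rw [h1, volume_pi_pi, Finset.prod_const, Finset.card_univ, Fintype.card_fin,
    prob_compl_eq_one_sub (measurable_subtype_coe hA), h2]

lemma lebesgue01_Ioo {a b : ℝ} (ha : 0 ≤ a) (hb : b ≤ 1) :
    lebesgue01 (Ioo a b) = ENNReal.ofReal (b - a) := by
  rw [Measure.restrict_apply measurableSet_Ioo,
    inter_eq_left.2 (Ioo_subset_Icc_self.trans (Icc_subset_Icc ha hb)), Real.volume_Ioo]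

lemma volume_avoid_Ioo_le {a b : ℝ} (ha : 0 ≤ a) (hb : b ≤ 1) :
    volume (avoid n (Ioo a b)) ≤ ENNReal.ofReal (Real.exp (-(n * (b - a)))) := by
  rw [volume_avoid measurableSet_Ioo, lebesgue01_Ioo ha hb]
  calc (1 - ENNReal.ofReal (b - a)) ^ n ≤ ENNReal.ofReal (Real.exp (-(b - a))) ^ n := by
        gcongr
        rw [tsub_le_iff_right]
        rcases le_total 0 (b - a) with h | h
        · rw [← ENNReal.ofReal_add (Real.exp_nonneg _) h, ← ENNReal.ofReal_one]
          apply ENNReal.ofReal_le_ofReal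
          linarith [Real.add_one_le_exp (-(b - a))]
        · refine le_add_right ?_
          rw [← ENNReal.ofReal_one]
          apply ENNReal.ofReal_le_ofReal
          exact Real.one_le_exp (by linarith)
    _ = _ := by
        rw [← ENNReal.ofReal_pow (Real.exp_nonneg _), ← Real.exp_nat_mul]
        ring_nf

/-- The constant in the bound for the `N`-th moment of a variable with exponential tails. -/
noncomputable def tailConst (N : ℕ) : ℝ≥0∞ :=
  ∑' k : ℕ, ENNReal.ofReal (((k : ℝ) + 1) ^ N * Real.exp (-k))

lemma tailConst_ne_top (N : ℕ) : tailConst N ≠ ⊤ := by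
  have h := (summable_nat_add_iff 1).2 (Real.summable_pow_mul_exp_neg_nat_mul N one_pos)
  have h2 : Summable fun k : ℕ => ((k : ℝ) + 1) ^ N * Real.exp (-k) := by
    refine (h.mul_right (Real.exp 1)).congr fun k => ?_
    rw [mul_assoc, ← Real.exp_add]
    push_cast
    ring_nf
  exact h2.tsum_ofReal_ne_top

lemma lintegral_pow_le_tailConst {Ω : Type*} [MeasurableSpace Ω] {μ : Measure Ω} {Y : Ω → ℝ}
    (hY : Measurable Y) (hY0 : ∀ ω, 0 ≤ Y ω)
    (htail : ∀ k : ℕ, μ {ω | (k : ℝ) ≤ Y ω} ≤ ENNReal.ofReal (Real.exp (-k)))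
    (N : ℕ) : ∫⁻ ω, ENNReal.ofReal (Y ω) ^ N ∂μ ≤ tailConst N := by
  have hms : ∀ k : ℕ, MeasurableSet {ω | (k : ℝ) ≤ Y ω} := fun k =>
    measurableSet_le measurable_const hY
  calc ∫⁻ ω, ENNReal.ofReal (Y ω) ^ N ∂μ
      ≤ ∫⁻ ω, ∑' k : ℕ, {ω | (k : ℝ) ≤ Y ω}.indicator
          (fun _ => ENNReal.ofReal (((k : ℝ) + 1) ^ N)) ω ∂μ := by
        refine lintegral_mono fun ω => ?_
        -- The term with index `⌊Y⌋` alone dominates `Y^N`, because `Y ≤ ⌊Y⌋ + 1`.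
        refine le_trans ?_ (ENNReal.le_tsum ⌊Y ω⌋₊)
        rw [indicator_of_mem (by exact Nat.floor_le (hY0 ω)), ← ENNReal.ofReal_pow (hY0 ω)]
        apply ENNReal.ofReal_le_ofReal
        have := hY0 ω
        gcongr
        exact (Nat.lt_floor_add_one _).le
    _ = ∑' k : ℕ, ENNReal.ofReal (((k : ℝ) + 1) ^ N) * μ {ω | (k : ℝ) ≤ Y ω} := by
        rw [lintegral_tsum fun k => (measurable_const.indicator (hms k)).aemeasurable]
        congr 1
        ext k
        rw [lintegral_indicator (hms k), setLIntegral_const]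
    _ ≤ tailConst N := by
        refine ENNReal.tsum_le_tsum fun k => ?_
        rw [ENNReal.ofReal_mul (by positivity)]
        gcongr
        exact htail k

/-- A distance of at least `k/n` to the next node means that `(t, t + k/n)` has no node, which has
probability at most `exp (-k)`; if that interval leaves `[0,1]`, the event is empty. -/
lemma lintegral_rightNode_le (hn : n ≠ 0) {t : ℝ} (ht : t ∈ Ico (0 : ℝ) 1) (N : ℕ) :
    ∫⁻ x : Fin n → unitInterval, ENNReal.ofReal (n * (rightNode x t - t)) ^ N
      ≤ tailConst N := by
  have hn0 : (0 : ℝ) < n := by positivity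
  refine lintegral_pow_le_tailConst ?_ (fun x => ?_) (fun k => ?_) N
  · exact measurable_const.mul ((measurable_rightNode_prod.comp measurable_prodMk_right).sub
      measurable_const)
  · exact mul_nonneg hn0.le (sub_nonneg.2 (lt_rightNode x ht).le)
  · by_cases h : t + k / n ≤ 1
    · refine (measure_mono (t := avoid n (Ioo t (t + k / n))) fun x hx i hi => ?_).trans
        ((volume_avoid_Ioo_le ht.1 h).trans_eq ?_)
      · have h1 : (rightNode x t : ℝ) ≤ x i := rightNode_le hi.1
        have h2 : (k : ℝ) / n ≤ rightNode x t - t := by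
          rw [div_le_iff₀' hn0]
          exact hx
        linarith [hi.2]
      · congr 3
        field_simp
        ring
    · have : {x : Fin n → unitInterval | (k : ℝ) ≤ n * (rightNode x t - t)} = ∅ := by
        refine eq_empty_iff_forall_notMem.2 fun x hx => h ?_
        have h2 : (k : ℝ) / n ≤ rightNode x t - t := by
          rw [div_le_iff₀' hn0]
          exact hx
        linarith [(rightNode x t).2.2]
      simp [this]

lemma lintegral_leftNode_le (hn : n ≠ 0) {t : ℝ} (ht : t ∈ Ico (0 : ℝ) 1) (N : ℕ) :
    ∫⁻ x : Fin n → unitInterval, ENNReal.ofReal (n * (t - leftNode x t)) ^ N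
      ≤ tailConst N := by
  have hn0 : (0 : ℝ) < n := by positivity
  refine lintegral_pow_le_tailConst ?_ (fun x => ?_) (fun k => ?_) N
  · exact measurable_const.mul (measurable_const.sub
      (measurable_leftNode_prod.comp measurable_prodMk_right))
  · exact mul_nonneg hn0.le (sub_nonneg.2 (leftNode_le x ht.1))
  · by_cases h : 0 ≤ t - k / n
    · refine (measure_mono (t := avoid n (Ioo (t - k / n) t)) fun x hx i hi => ?_).trans
        ((volume_avoid_Ioo_le h ht.2.le).trans_eq ?_)
      · have h1 : (x i : ℝ) ≤ leftNode x t := le_leftNode hi.2.le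
        have h2 : (k : ℝ) / n ≤ t - leftNode x t := by
          rw [div_le_iff₀' hn0]
          exact hx
        linarith [hi.1]
      · congr 3
        field_simp
        ring
    · have : {x : Fin n → unitInterval | (k : ℝ) ≤ n * (t - leftNode x t)} = ∅ := by
        refine eq_empty_iff_forall_notMem.2 fun x hx => h ?_
        have h2 : (k : ℝ) / n ≤ t - leftNode x t := by
          rw [div_le_iff₀' hn0]
          exact hx
        linarith [(leftNode x t).2.1]
      simp [this]

lemma add_pow_le_two_pow_mul (a b : ℝ≥0∞) (N : ℕ) :
    (a + b) ^ N ≤ 2 ^ N * (a ^ N + b ^ N) := by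
  rcases le_total a b with h | h
  · calc (a + b) ^ N ≤ (2 * b) ^ N := by
          gcongr
          rw [two_mul]
          gcongr
      _ ≤ _ := by
        rw [mul_pow]
        gcongr
        exact le_add_self
  · calc (a + b) ^ N ≤ (2 * a) ^ N := by
          gcongr
          rw [two_mul]
          gcongr
      _ ≤ _ := by
        rw [mul_pow]
        gcongr
        exact le_self_add

lemma lintegral_length_pow_le (hn : n ≠ 0) {t : ℝ} (ht : t ∈ Ico (0 : ℝ) 1) (N : ℕ) :
    ∫⁻ x : Fin n → unitInterval, ((n : ℝ≥0∞) * (isPartition_nodes x).length t) ^ N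
      ≤ 2 ^ N * (tailConst N + tailConst N) := by
  have hn0 : (0 : ℝ) < n := by positivity
  have hm1 : Measurable fun x : Fin n → unitInterval =>
      ENNReal.ofReal (n * (rightNode x t - t)) ^ N :=
    (measurable_const.mul ((measurable_rightNode_prod.comp measurable_prodMk_right).sub
      measurable_const)).ennreal_ofReal.pow_const N
  have hm2 : Measurable fun x : Fin n → unitInterval =>
      ENNReal.ofReal (n * (t - leftNode x t)) ^ N :=
    (measurable_const.mul (measurable_const.sub
      (measurable_leftNode_prod.comp measurable_prodMk_right))).ennreal_ofReal.pow_const N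
  calc ∫⁻ x : Fin n → unitInterval, ((n : ℝ≥0∞) * (isPartition_nodes x).length t) ^ N
      ≤ ∫⁻ x : Fin n → unitInterval, 2 ^ N * (ENNReal.ofReal (n * (rightNode x t - t)) ^ N
          + ENNReal.ofReal (n * (t - leftNode x t)) ^ N) := by
        refine lintegral_mono fun x => ?_
        refine le_trans (le_of_eq ?_) (add_pow_le_two_pow_mul _ _ N)
        have h1 := (lt_rightNode x ht).le
        have h2 := leftNode_le x ht.1
        rw [← ENNReal.ofReal_add (mul_nonneg hn0.le (sub_nonneg.2 h1))
          (mul_nonneg hn0.le (sub_nonneg.2 h2)), ← mul_add, ENNReal.ofReal_mul hn0.le,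
          ENNReal.ofReal_natCast]
        simp [IsPartition.length]
    _ = 2 ^ N * ((∫⁻ x : Fin n → unitInterval, ENNReal.ofReal (n * (rightNode x t - t)) ^ N)
          + ∫⁻ x : Fin n → unitInterval, ENNReal.ofReal (n * (t - leftNode x t)) ^ N) := by
        rw [← lintegral_add_left hm1]
        exact lintegral_const_mul _ (hm1.add hm2)
    _ ≤ _ := by
        gcongr
        · exact lintegral_rightNode_le hn ht N
        · exact lintegral_leftNode_le hn ht N

lemma measurable_length_prod :
    Measurable fun z : (Fin n → unitInterval) × ℝ => (isPartition_nodes z.1).length z.2 :=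
  (measurable_rightNode_prod.sub measurable_leftNode_prod).ennreal_ofReal

/-- The upper bound for the expected radius in the case `q < p`. -/
lemma exists_expectedRadius_le {p q : ℝ≥0∞} (hq : 1 ≤ q) (hqp : q < p) :
    ∃ C : ℝ≥0∞, C ≠ ⊤ ∧ ∀ n : ℕ, n ≠ 0 → expectedRadius p q n ≤ C * (n : ℝ≥0∞)⁻¹ := by
  obtain ⟨r, hqr, hrp⟩ := exists_between hqp
  have hr : r ≠ ⊤ := hrp.ne_top
  have hq' : q ≠ ⊤ := hqr.ne_top
  have hQ : 0 < q.toReal := ENNReal.toReal_pos (by positivity) hq'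
  have hQ1 : 1 ≤ q.toReal := by simpa using ENNReal.toReal_mono hq' hq
  have hQR : q.toReal < r.toReal := (ENNReal.toReal_lt_toReal hq' hr).2 hqr
  set α : ℝ := (1 / q.toReal - 1 / r.toReal)⁻¹ with hα
  have hα0 : 0 < α := by
    rw [hα, inv_pos, sub_pos]
    exact one_div_lt_one_div_of_lt hQ hQR
  have hα1 : 1 / α ≤ 1 := by
    rw [one_div, hα, inv_inv]
    have h1 : 1 / q.toReal ≤ 1 := by
      rw [div_le_one hQ]
      exact hQ1
    have : 0 < 1 / r.toReal := one_div_pos.2 (hQ.trans hQR)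
    linarith
  -- Real powers are replaced by an integer moment through `y^α ≤ 1 + y^N` and `y^(1/α) ≤ 1 + y`.
  -- After scaling the lengths by `n`, Tonelli's theorem reduces the claim to the moment bound at a
  -- fixed `t`.
  set N := ⌈α⌉₊
  refine ⟨(2 + 2 ^ N * (tailConst N + tailConst N)) * 2, ?_, fun n hn => ?_⟩
  · have := tailConst_ne_top N
    finiteness
  have hn0 : (n : ℝ≥0∞) ≠ 0 := by simpa using hn
  have hnt : (n : ℝ≥0∞) ≠ ⊤ := ENNReal.natCast_ne_top n
  have hpow : ∀ y : ℝ≥0∞, y ^ α ≤ 1 + y ^ N := by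
    intro y
    rcases le_total y 1 with hy | hy
    · exact le_add_right (ENNReal.rpow_le_one hy hα0.le)
    · refine le_add_left ?_
      rw [← ENNReal.rpow_natCast]
      exact ENNReal.rpow_le_rpow_of_exponent_le hy (Nat.le_ceil α)
  have hroot : ∀ y : ℝ≥0∞, y ^ (1 / α) ≤ 1 + y := by
    intro y
    rcases le_total y 1 with hy | hy
    · exact le_add_right (ENNReal.rpow_le_one hy (by positivity))
    · refine le_add_left ?_
      simpa using ENNReal.rpow_le_rpow_of_exponent_le hy hα1
  have hvol : ∫⁻ _ in Ico (0 : ℝ) 1, (1 : ℝ≥0∞) = 1 := by simp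
  have hrad : ∀ x : Fin n → unitInterval, radius p q x ≤
      (2 + ∫⁻ t in Ico (0 : ℝ) 1, ((n : ℝ≥0∞) * (isPartition_nodes x).length t) ^ N)
        * (2 * (n : ℝ≥0∞)⁻¹) := by
    intro x
    set h := isPartition_nodes x
    have hm := h.measurable_length
    calc radius p q x ≤ (∫⁻ t in Ico (0 : ℝ) 1, h.length t ^ α) ^ (1 / α) * 2 :=
          radius_le_lintegral_length hq hqr hr hrp.le hn x hα
      _ = (∫⁻ t in Ico (0 : ℝ) 1, ((n : ℝ≥0∞) * h.length t) ^ α) ^ (1 / α)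
            * (2 * (n : ℝ≥0∞)⁻¹) := by
          have h1 : ∀ t, h.length t ^ α = ((n : ℝ≥0∞)⁻¹) ^ α * ((n : ℝ≥0∞) * h.length t) ^ α := by
            intro t
            rw [← ENNReal.mul_rpow_of_nonneg _ _ hα0.le, ← mul_assoc,
              ENNReal.inv_mul_cancel hn0 hnt, one_mul]
          simp_rw [h1]
          rw [lintegral_const_mul _ ((hm.const_mul _).pow_const _),
            ENNReal.mul_rpow_of_nonneg _ _ (by positivity), ← ENNReal.rpow_mul,
            mul_one_div_cancel hα0.ne', ENNReal.rpow_one]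
          ring
      _ ≤ (1 + ∫⁻ t in Ico (0 : ℝ) 1, (1 + ((n : ℝ≥0∞) * h.length t) ^ N))
            * (2 * (n : ℝ≥0∞)⁻¹) := by
          gcongr
          refine (hroot _).trans ?_
          gcongr with t
          exact hpow _
      _ = _ := by
          rw [lintegral_add_left measurable_const, hvol, ← add_assoc, one_add_one_eq_two]
  have hjoint : Measurable fun z : (Fin n → unitInterval) × ℝ =>
      ((n : ℝ≥0∞) * (isPartition_nodes z.1).length z.2) ^ N :=
    (measurable_length_prod.const_mul _).pow_const _
  calc expectedRadius p q n
      ≤ ∫⁻ x : Fin n → unitInterval,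
          (2 + ∫⁻ t in Ico (0 : ℝ) 1, ((n : ℝ≥0∞) * (isPartition_nodes x).length t) ^ N)
            * (2 * (n : ℝ≥0∞)⁻¹) := lintegral_mono hrad
    _ = (2 + ∫⁻ x : Fin n → unitInterval, ∫⁻ t in Ico (0 : ℝ) 1,
          ((n : ℝ≥0∞) * (isPartition_nodes x).length t) ^ N) * (2 * (n : ℝ≥0∞)⁻¹) := by
        have hm : Measurable fun x : Fin n → unitInterval => ∫⁻ t in Ico (0 : ℝ) 1,
            ((n : ℝ≥0∞) * (isPartition_nodes x).length t) ^ N := hjoint.lintegral_prod_right'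
        rw [lintegral_mul_const _ (hm.const_add 2), lintegral_add_left measurable_const]
        simp
    _ = (2 + ∫⁻ t in Ico (0 : ℝ) 1, ∫⁻ x : Fin n → unitInterval,
          ((n : ℝ≥0∞) * (isPartition_nodes x).length t) ^ N) * (2 * (n : ℝ≥0∞)⁻¹) := by
        rw [lintegral_lintegral_swap hjoint.aemeasurable]
    _ ≤ (2 + ∫⁻ t in Ico (0 : ℝ) 1, 2 ^ N * (tailConst N + tailConst N))
          * (2 * (n : ℝ≥0∞)⁻¹) := by
        refine mul_le_mul_left (add_le_add le_rfl ?_) _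
        exact setLIntegral_mono' measurableSet_Ico fun t ht => lintegral_length_pow_le hn ht N
    _ = _ := by
        simp
        ring

/-! ### Empty cells: union bound and second moment method. -/

/-- The `j`-th of the `m` open intervals of equal length in `[0,1]`. -/
def cell (m j : ℕ) : Set ℝ := Ioo ((j : ℝ) / m) (((j : ℝ) + 1) / m)

lemma measurableSet_cell (m j : ℕ) : MeasurableSet (cell m j) := measurableSet_Ioo

lemma cell_right_le_one {m j : ℕ} (hj : j < m) : ((j : ℝ) + 1) / m ≤ 1 := by
  have hm : (0 : ℝ) < m := by exact_mod_cast (Nat.zero_le j).trans_lt hj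
  rw [div_le_one hm]
  exact_mod_cast hj

lemma lebesgue01_cell {m j : ℕ} (hj : j < m) :
    lebesgue01 (cell m j) = ENNReal.ofReal (1 / m) := by
  rw [cell, lebesgue01_Ioo (by positivity) (cell_right_le_one hj)]
  congr 1
  ring

lemma disjoint_cell {m : ℕ} {i j : ℕ} (hij : i ≠ j) : Disjoint (cell m i) (cell m j) := by
  wlog h : i < j generalizing i j
  · exact (this hij.symm (lt_of_le_of_ne (not_lt.1 h) hij.symm)).symm
  rw [Set.disjoint_left]
  intro u hu hv
  have : ((i : ℝ) + 1) / m ≤ j / m := by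
    gcongr
    exact_mod_cast h
  linarith [hu.2, hv.1]

lemma exists_mem_Icc_cell {m : ℕ} (hm : m ≠ 0) {t : ℝ} (ht : t ∈ Icc (0 : ℝ) 1) :
    ∃ j < m, t ∈ Icc ((j : ℝ) / m) (((j : ℝ) + 1) / m) := by
  have hm0 : (0 : ℝ) < m := by positivity
  rcases eq_or_lt_of_le ht.2 with h1 | h1
  · refine ⟨m - 1, Nat.sub_lt (Nat.pos_of_ne_zero hm) one_pos, ?_⟩
    rw [Nat.cast_sub (Nat.one_le_iff_ne_zero.2 hm), h1]
    constructor
    · rw [div_le_one hm0]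
      simp
    · rw [le_div_iff₀ hm0]
      simp
  · refine ⟨⌊t * m⌋₊, ?_, ?_, ?_⟩
    · rw [Nat.floor_lt (mul_nonneg ht.1 hm0.le)]
      nlinarith
    · rw [div_le_iff₀ hm0]
      exact Nat.floor_le (mul_nonneg ht.1 hm0.le)
    · rw [le_div_iff₀ hm0]
      exact (Nat.lt_floor_add_one _).le

/-- If every cell contains a node, then the radius is small. -/
lemma radius_le_of_forall_notMem_avoid {p q : ℝ≥0∞} (hp : 1 ≤ p) (hpq : p ≤ q) (hn : n ≠ 0)
    {m : ℕ} (hm : m ≠ 0) {x : Fin n → unitInterval} (hx : ∀ j < m, x ∉ avoid n (cell m j)) :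
    radius p q x ≤ ENNReal.ofReal (2 * (1 / m)) ^ (1 - p⁻¹.toReal + q⁻¹.toReal) * 2 := by
  refine radius_le_of_cover hp hpq hn fun t ht => ?_
  obtain ⟨j, hj, htj⟩ := exists_mem_Icc_cell hm ht
  have := hx j hj
  simp only [avoid, mem_ofPred_eq, not_forall, not_not] at this
  obtain ⟨i, hi⟩ := this
  refine ⟨i, ?_⟩
  have h1 : ((j : ℝ) + 1) / m = j / m + 1 / m := by ring
  rw [cell, h1] at hi
  rw [h1] at htj
  rw [abs_le]
  constructor <;> linarith [hi.1, hi.2, htj.1, htj.2]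

/-- The upper bound for the expected radius in the case `p ≤ q`. -/
lemma expectedRadius_le {p q : ℝ≥0∞} (hp : 1 ≤ p) (hpq : p ≤ q) (hn : n ≠ 0)
    {m : ℕ} (hm : m ≠ 0) :
    expectedRadius p q n ≤ ENNReal.ofReal (2 * (1 / m)) ^ (1 - p⁻¹.toReal + q⁻¹.toReal) * 2
      + 2 * ENNReal.ofReal (m * Real.exp (-(n / m))) := by
  -- Some cell is empty. The union bound controls the probability of this event, on which the
  -- trivial bound `2` for the radius is used.
  set bad : Set (Fin n → unitInterval) := ⋃ j ∈ Finset.range m, avoid n (cell m j) with hbad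
  have hbm : MeasurableSet bad :=
    Finset.measurableSet_biUnion _ fun j _ => measurableSet_avoid (measurableSet_cell m j)
  set B := ENNReal.ofReal (2 * (1 / m)) ^ (1 - p⁻¹.toReal + q⁻¹.toReal) * 2
  have hvol : volume bad ≤ ENNReal.ofReal (m * Real.exp (-(n / m))) := by
    calc volume bad ≤ ∑ j ∈ Finset.range m, volume (avoid n (cell m j)) :=
          measure_biUnion_finset_le _ _
      _ ≤ ∑ j ∈ Finset.range m, ENNReal.ofReal (Real.exp (-(n / m))) := by
          refine Finset.sum_le_sum fun j hj => ?_
          refine (volume_avoid_Ioo_le (by positivity)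
            (cell_right_le_one (Finset.mem_range.1 hj))).trans_eq ?_
          congr 3
          ring
      _ = _ := by
          rw [Finset.sum_const, Finset.card_range, nsmul_eq_mul, ENNReal.ofReal_mul (by positivity),
            ENNReal.ofReal_natCast]
  calc expectedRadius p q n ≤ ∫⁻ x : Fin n → unitInterval, (B + bad.indicator (fun _ => 2) x) := by
        refine lintegral_mono fun x => ?_
        by_cases hx : x ∈ bad
        · rw [indicator_of_mem hx]
          exact le_add_left (radius_le_two hp hpq hn x)
        · refine le_add_right (radius_le_of_forall_notMem_avoid hp hpq hn hm fun j hj hxj => ?_)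
          exact hx (mem_biUnion (Finset.mem_coe.2 (Finset.mem_range.2 hj)) hxj)
    _ = B + 2 * volume bad := by
        rw [lintegral_add_left measurable_const, lintegral_indicator hbm, setLIntegral_const]
        simp
    _ ≤ _ := by gcongr

/-- Equispaced nodes. -/
lemma optimalRadius_le {p q : ℝ≥0∞} (hp : 1 ≤ p) (hpq : p ≤ q) {m : ℕ} (hm : m ≠ 0) :
    optimalRadius p q m
      ≤ ENNReal.ofReal (2 * (1 / m)) ^ (1 - p⁻¹.toReal + q⁻¹.toReal) * 2 := by
  have hm0 : (0 : ℝ) < m := by positivity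
  have hmem : ∀ j : Fin m, (j : ℝ) / m ∈ Icc (0 : ℝ) 1 := fun j =>
    ⟨by positivity, (div_le_one hm0).2 (by exact_mod_cast j.2.le)⟩
  refine iInf_le_of_le (fun j : Fin m => ⟨(j : ℝ) / m, hmem j⟩)
    (radius_le_of_cover hp hpq hm fun t ht => ?_)
  obtain ⟨j, hj, htj⟩ := exists_mem_Icc_cell hm ht
  refine ⟨⟨j, hj⟩, ?_⟩
  have h1 : ((j : ℝ) + 1) / m = j / m + 1 / m := by ring
  have h2 : 0 < 1 / (m : ℝ) := by positivity
  rw [h1] at htj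
  simp only
  rw [abs_le]
  constructor <;> linarith [htj.1, htj.2]

/-- Second moment method. -/
lemma half_le_measureReal_iUnion {Ω ι : Type*} [MeasurableSpace Ω] {μ : Measure Ω}
    [IsProbabilityMeasure μ] [Fintype ι] {A : ι → Set Ω} (hA : ∀ i, MeasurableSet (A i)) {π : ℝ}
    (h1 : ∀ i, μ.real (A i) = π) (h2 : ∀ i j, i ≠ j → μ.real (A i ∩ A j) ≤ π ^ 2)
    (hπ : 1 ≤ Fintype.card ι * π) : 1 / 2 ≤ μ.real (⋃ i, A i) := by
  classical
  set ν : ℝ := Fintype.card ι * π with hν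
  set Z : Ω → ℝ := fun ω => ∑ i, (A i).indicator 1 ω with hZ
  have hint : ∀ i, Integrable ((A i).indicator (1 : Ω → ℝ)) μ := fun i =>
    (integrable_const 1).indicator (hA i)
  have hU : MeasurableSet (⋃ i, A i) := MeasurableSet.iUnion hA
  have hintZ : Integrable Z μ := integrable_finsetSum _ fun i _ => hint i
  have hZZ : ∀ ω, Z ω ^ 2 = ∑ i, ∑ j, (A i ∩ A j).indicator (1 : Ω → ℝ) ω := by
    intro ω
    rw [hZ, pow_two, Finset.sum_mul_sum]
    refine Finset.sum_congr rfl fun i _ => Finset.sum_congr rfl fun j _ => ?_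
    rw [Set.inter_indicator_one]
    rfl
  have hint2 : ∀ i j, Integrable ((A i ∩ A j).indicator (1 : Ω → ℝ)) μ := fun i j =>
    (integrable_const 1).indicator ((hA i).inter (hA j))
  have hintZZ : Integrable (fun ω => Z ω ^ 2) μ := by
    simp_rw [hZZ]
    exact integrable_finsetSum _ fun i _ => integrable_finsetSum _ fun j _ => hint2 i j
  have hEZ : ∫ ω, Z ω ∂μ = ν := by
    rw [hZ, integral_finsetSum _ fun i _ => hint i]
    simp_rw [integral_indicator_one (hA _), h1]
    simp [hν]
  have hEZZ : ∫ ω, Z ω ^ 2 ∂μ ≤ ν + ν ^ 2 := by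
    simp_rw [hZZ]
    rw [integral_finsetSum _ fun i _ => integrable_finsetSum _ fun j _ => hint2 i j]
    simp_rw [integral_finsetSum Finset.univ fun j _ => hint2 _ j,
      integral_indicator_one ((hA _).inter (hA _))]
    calc ∑ i, ∑ j, μ.real (A i ∩ A j) ≤ ∑ i : ι, ∑ j : ι, ((if i = j then π else 0) + π ^ 2) := by
          refine Finset.sum_le_sum fun i _ => Finset.sum_le_sum fun j _ => ?_
          split_ifs with hij
          · rw [hij, inter_self, h1]
            nlinarith
          · rw [zero_add]
            exact h2 i j hij
      _ = ν + ν ^ 2 := by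
          simp [Finset.sum_add_distrib, hν]
          ring
  -- This value maximises `2aν - a²(ν + ν²)`. Integrating `2aZ ≤ 1_U + a²Z²`, where `U` is the
  -- union, then gives `μ U ≥ ν / (1 + ν)`, which is at least `1/2`.
  set a : ℝ := 1 / (1 + ν) with ha
  have hpt : ∀ ω, 2 * a * Z ω ≤ (⋃ i, A i).indicator (1 : Ω → ℝ) ω + a ^ 2 * Z ω ^ 2 := by
    intro ω
    by_cases hω : ω ∈ ⋃ i, A i
    · rw [indicator_of_mem hω]
      simp only [Pi.one_apply]
      nlinarith [sq_nonneg (1 - a * Z ω)]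
    · have : Z ω = 0 := by
        rw [hZ]
        refine Finset.sum_eq_zero fun i _ => ?_
        rw [indicator_of_notMem]
        exact fun hi => hω (mem_iUnion.2 ⟨i, hi⟩)
      simp [this, indicator_of_notMem hω]
  have hintU : Integrable ((⋃ i, A i).indicator (1 : Ω → ℝ)) μ :=
    (integrable_const 1).indicator hU
  have hI := integral_mono (hintZ.const_mul (2 * a)) (hintU.add (hintZZ.const_mul (a ^ 2))) hpt
  simp only [Pi.add_apply] at hI
  rw [integral_add hintU (hintZZ.const_mul _), integral_const_mul, integral_const_mul,
    integral_indicator_one hU, hEZ] at hI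
  have h3 : a ^ 2 * ∫ ω, Z ω ^ 2 ∂μ ≤ a ^ 2 * (ν + ν ^ 2) := by gcongr
  have h4 : 2 * a * ν - a ^ 2 * (ν + ν ^ 2) = ν / (1 + ν) := by
    rw [ha]
    field_simp
    ring
  have h5 : 1 / 2 ≤ ν / (1 + ν) := by
    rw [div_le_div_iff₀ (by norm_num) (by linarith)]
    linarith
  linarith

/-- Emptiness of two distinct cells is negatively correlated, since `1 - 2/m ≤ (1 - 1/m)^2`. The
hypothesis `hm` says that the expected number of empty cells is at least `1`. -/
lemma half_le_volume_exists_avoid {m : ℕ} (hm : 1 ≤ (m : ℝ) * (1 - 1 / m) ^ n) (hm2 : 2 ≤ m) :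
    1 / 2 ≤ volume (⋃ j : Fin m, avoid n (cell m j)) := by
  have hm0 : (2 : ℝ) ≤ m := by exact_mod_cast hm2
  have hinv : 1 / (m : ℝ) ≤ 1 / 2 := one_div_le_one_div_of_le (by norm_num) hm0
  have hinv0 : 0 < 1 / (m : ℝ) := by positivity
  have h := half_le_measureReal_iUnion (μ := (volume : Measure (Fin n → unitInterval)))
    (A := fun j : Fin m => avoid n (cell m j)) (π := (1 - 1 / m) ^ n)
    (fun j => measurableSet_avoid (measurableSet_cell m j)) ?_ ?_ (by simpa using hm)
  · rw [measureReal_def, ← ENNReal.ofReal_le_iff_le_toReal (measure_ne_top _ _)] at h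
    refine le_trans (le_of_eq ?_) h
    rw [ENNReal.ofReal_div_of_pos (by norm_num)]
    simp
  · intro j
    rw [measureReal_def, volume_avoid (measurableSet_cell m j), lebesgue01_cell j.2,
      ← ENNReal.ofReal_one, ← ENNReal.ofReal_sub _ hinv0.le,
      ← ENNReal.ofReal_pow (by linarith), ENNReal.toReal_ofReal (by
        have : 0 ≤ 1 - 1 / (m : ℝ) := by linarith
        positivity)]
  · intro i j hij
    have hij' : (i : ℕ) ≠ j := fun h => hij (Fin.ext h)
    rw [avoid_inter, measureReal_def, volume_avoid
      ((measurableSet_cell m i).union (measurableSet_cell m j)),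
      measure_union (disjoint_cell hij') (measurableSet_cell m j), lebesgue01_cell i.2,
      lebesgue01_cell j.2, ← ENNReal.ofReal_add hinv0.le hinv0.le, ← ENNReal.ofReal_one,
      ← ENNReal.ofReal_sub _ (by positivity), ← ENNReal.ofReal_pow (by linarith),
      ENNReal.toReal_ofReal (pow_nonneg (by linarith) n), ← pow_mul, mul_comm n 2, pow_mul]
    gcongr
    · linarith
    · nlinarith

end Probability

/-! ### Lower bounds: functions that vanish at the nodes. -/

lemma neg_mem_unitBall {p : ℝ≥0∞} {h : ℝ → ℝ} (hh : h ∈ unitBall p) : -h ∈ unitBall p := by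
  obtain ⟨⟨h1, h2⟩, h3⟩ := hh
  have hd : deriv (-h) = -deriv h := by
    ext t
    exact deriv.neg
  refine ⟨⟨h1.neg, by rw [hd]; exact h2.neg⟩, ?_⟩
  unfold sobolevNorm at h3 ⊢
  rwa [hd, eLpNorm_neg, eLpNorm_neg, eLpNorm_neg, eLpNorm_neg]

/-- Functions in the ball that vanish at the nodes bound the radius from below. -/
lemma eLpNorm_le_radius {p q : ℝ≥0∞} (hq : 1 ≤ q) {n : ℕ} {x : Fin n → unitInterval}
    {h : ℝ → ℝ} (hh : h ∈ unitBall p) (hx : ∀ i, h (x i) = 0) :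
    eLpNorm h q lebesgue01 ≤ radius p q x := by
  refine le_iInf fun φ => ?_
  set B := ⨆ f ∈ unitBall p, eLpNorm (fun t => f t - φ (info x f) t) q lebesgue01
  have hm : AEStronglyMeasurable h lebesgue01 :=
    (by simpa [uIcc_of_le (zero_le_one (α := ℝ))] using hh.1.1.continuousOn :
      ContinuousOn h (Icc 0 1)).aestronglyMeasurable measurableSet_Icc
  have hi : info x h = 0 := funext hx
  have hi' : info x (-h) = 0 := by
    ext i
    simp [info, hx]
  -- The functions `h` and `-h` have the same zero data, so the algorithm returns the same `g` for
  -- both, and `2‖h‖` is at most the sum of the two errors.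
  set g := φ 0
  have hgm := Lp.aestronglyMeasurable g
  have h1 : eLpNorm (fun t => h t - g t) q lebesgue01 ≤ B :=
    le_iSup₂_of_le h hh (by rw [hi])
  have h2 : eLpNorm (fun t => (-h) t - g t) q lebesgue01 ≤ B :=
    le_iSup₂_of_le (-h) (neg_mem_unitBall hh) (by rw [hi'])
  have h3 : (fun t => h t - g t) - (fun t => (-h) t - g t) = (2 : ℝ) • h := by
    ext t
    simp
    ring
  have h4 := eLpNorm_sub_le (hm.sub hgm) (hm.neg.sub hgm) hq
  have h5 : eLpNorm ((2 : ℝ) • h) q lebesgue01 ≤ B + B := by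
    rw [← h3]
    exact h4.trans (add_le_add h1 h2)
  rw [eLpNorm_const_smul, ← two_mul, Real.enorm_of_nonneg zero_le_two, ENNReal.ofReal_ofNat] at h5
  exact (ENNReal.mul_le_mul_iff_right two_ne_zero ENNReal.ofNat_ne_top).1 h5

/-- The threshold `1/2` works for every `p ≥ 1` because `2 * 2^(-p) ≤ 1`. -/
lemma mem_unitBall_of_lipschitzWith {p : ℝ≥0∞} (hp : 1 ≤ p) {h : ℝ → ℝ} {K : ℝ≥0}
    (hK : LipschitzWith K h) (h0 : eLpNorm h p lebesgue01 ≤ 2⁻¹)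
    (h1 : eLpNorm (deriv h) p lebesgue01 ≤ 2⁻¹) : h ∈ unitBall p := by
  refine ⟨⟨hK.lipschitzOnWith.absolutelyContinuousOnInterval,
    (measurable_deriv h).aestronglyMeasurable, h1.trans_lt (by simp)⟩, ?_⟩
  unfold sobolevNorm
  have h2 : (2⁻¹ : ℝ≥0∞) ≤ 1 := by simp
  split_ifs with hp'
  · subst hp'
    exact max_le (h0.trans h2) (h1.trans h2)
  · have hp0 : 0 < p.toReal := ENNReal.toReal_pos (by positivity) hp'
    have hp1 : 1 ≤ p.toReal := by simpa using ENNReal.toReal_mono hp' hp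
    rw [one_div, ENNReal.rpow_inv_le_iff hp0, ENNReal.one_rpow]
    calc _ ≤ (2⁻¹ : ℝ≥0∞) ^ p.toReal + 2⁻¹ ^ p.toReal := by gcongr
      _ ≤ (2⁻¹ : ℝ≥0∞) ^ (1 : ℝ) + 2⁻¹ ^ (1 : ℝ) := by
        have h3 := ENNReal.rpow_le_rpow_of_exponent_ge h2 hp1
        exact add_le_add h3 h3
      _ = 1 := by rw [ENNReal.rpow_one, ENNReal.inv_two_add_inv_two]

/-- The function with slopes `±A` supported on `[c - w, c + w]`. -/
def tent (A c w t : ℝ) : ℝ := A * max 0 (w - |t - c|)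

lemma tent_of_notMem {A c w t : ℝ} (ht : t ∉ Ioo (c - w) (c + w)) : tent A c w t = 0 := by
  have : w - |t - c| ≤ 0 := by
    by_contra! h
    have := abs_lt.1 (sub_pos.1 h)
    exact ht ⟨by linarith, by linarith⟩
  rw [tent, max_eq_left this, mul_zero]

lemma lipschitzWith_tent (A c w : ℝ) : LipschitzWith ‖A‖₊ (tent A c w) := by
  refine LipschitzWith.of_dist_le_mul fun s t => ?_
  rw [Real.dist_eq, Real.dist_eq, tent, tent, ← mul_sub, abs_mul, coe_nnnorm, Real.norm_eq_abs]
  refine mul_le_mul_of_nonneg_left ?_ (abs_nonneg A)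
  calc |max 0 (w - |s - c|) - max 0 (w - |t - c|)|
      ≤ max |(0 : ℝ) - 0| |w - |s - c| - (w - |t - c|)| := abs_max_sub_max_le_max ..
    _ ≤ |s - t| := by
      rw [sub_self, abs_zero, max_le_iff]
      refine ⟨abs_nonneg _, ?_⟩
      have := abs_abs_sub_abs_le_abs_sub (t - c) (s - c)
      rw [abs_sub_comm s t]
      refine le_trans (le_of_eq ?_) (this.trans_eq ?_) <;> congr 1 <;> ring

lemma eLpNorm_le_of_abs_le_indicator {p : ℝ≥0∞} {h : ℝ → ℝ} {A c w : ℝ} (hA : 0 ≤ A)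
    (hh : ∀ t, |h t| ≤ (Icc (c - w) (c + w)).indicator (fun _ => A) t) :
    eLpNorm h p lebesgue01 ≤ ENNReal.ofReal A * ENNReal.ofReal (2 * w) ^ p⁻¹.toReal := by
  calc eLpNorm h p lebesgue01
      ≤ eLpNorm ((Icc (c - w) (c + w)).indicator fun _ => A) p lebesgue01 :=
        eLpNorm_mono_real hh
    _ ≤ ‖A‖ₑ * lebesgue01 (Icc (c - w) (c + w)) ^ (1 / p.toReal) :=
        eLpNorm_indicator_const_le A p
    _ ≤ _ := by
      rw [Real.enorm_of_nonneg hA, ENNReal.toReal_inv, one_div]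
      gcongr
      refine (Measure.restrict_apply_le _ _).trans_eq ?_
      rw [Real.volume_Icc]
      congr 1
      ring

/-- The contribution of an interval without nodes. -/
lemma rpow_le_radius {p q : ℝ≥0∞} (hp : 1 ≤ p) (hq : 1 ≤ q) {n : ℕ} {x : Fin n → unitInterval}
    {c w : ℝ} (hw : 0 < w) (h0 : 0 ≤ c - w) (h1 : c + w ≤ 1)
    (hx : x ∈ avoid n (Ioo (c - w) (c + w))) :
    ENNReal.ofReal (w ^ (1 - p⁻¹.toReal + q⁻¹.toReal) / 8) ≤ radius p q x := by
  set a := p⁻¹.toReal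
  set b := q⁻¹.toReal
  have ha1 : 0 ≤ 1 - a := IsPartition.one_sub_inv_toReal_nonneg hp
  have hb1 : 0 ≤ 1 - b := IsPartition.one_sub_inv_toReal_nonneg hq
  have ha0 : 0 ≤ a := ENNReal.toReal_nonneg
  have hw1 : w ≤ 1 := by linarith
  -- The slope is normalised so that the constant `A` on an interval of length `2w` has `L_p` norm
  -- `1/2`. Since `w ≤ 1`, both the tent and its derivative are dominated by that constant.
  set A : ℝ := (2 * w) ^ (-a) / 2 with hA
  have hA0 : 0 < A := by positivity
  have hAw : ENNReal.ofReal A * ENNReal.ofReal (2 * w) ^ a = 2⁻¹ := by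
    rw [ENNReal.ofReal_rpow_of_pos (by positivity), ← ENNReal.ofReal_mul hA0.le, hA,
      div_mul_eq_mul_div, ← Real.rpow_add (by positivity), neg_add_cancel, Real.rpow_zero,
      ENNReal.ofReal_div_of_pos two_pos]
    simp
  have hlip := lipschitzWith_tent A c w
  have hball : tent A c w ∈ unitBall p := by
    refine mem_unitBall_of_lipschitzWith hp hlip ?_ ?_ <;> rw [← hAw] <;>
      refine eLpNorm_le_of_abs_le_indicator (c := c) hA0.le fun t => ?_
    · by_cases ht : t ∈ Icc (c - w) (c + w)
      · rw [indicator_of_mem ht, tent, abs_of_nonneg (by positivity)]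
        have : max 0 (w - |t - c|) ≤ 1 := max_le zero_le_one (by linarith [abs_nonneg (t - c)])
        nlinarith
      · rw [indicator_of_notMem ht, tent_of_notMem fun h => ht (Ioo_subset_Icc_self h), abs_zero]
    · by_cases ht : t ∈ Icc (c - w) (c + w)
      · rw [indicator_of_mem ht]
        have := norm_deriv_le_of_lipschitz (x₀ := t) hlip
        rwa [coe_nnnorm, Real.norm_of_nonneg hA0.le] at this
      · rw [indicator_of_notMem ht]
        have : tent A c w =ᶠ[𝓝 t] fun _ => 0 := by
          filter_upwards [isClosed_Icc.isOpen_compl.mem_nhds ht] with s hs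
          exact tent_of_notMem fun h => hs (Ioo_subset_Icc_self h)
        rw [this.deriv_eq]
        simp
  refine le_trans ?_ (eLpNorm_le_radius hq hball fun i => tent_of_notMem (hx i))
  -- On the middle half the tent is at least `A w / 2`. As `2^(-a) ≥ 1/2`, this is at least `w^(1 -
  -- a) / 8`, and the length `w` of `J` supplies `w^b`.
  set J := Icc (c - w / 2) (c + w / 2) with hJ
  have hJvol : lebesgue01 J = ENNReal.ofReal w := by
    rw [Measure.restrict_apply measurableSet_Icc,
      inter_eq_left.2 (Icc_subset_Icc (by linarith) (by linarith)), Real.volume_Icc]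
    congr 1
    ring
  have hJ0 : lebesgue01 J ≠ 0 := by
    rw [hJvol]
    simpa using hw
  calc ENNReal.ofReal (w ^ (1 - a + b) / 8)
      ≤ ENNReal.ofReal (A * w / 2) * ENNReal.ofReal w ^ b := by
        rw [ENNReal.ofReal_rpow_of_pos hw, ← ENNReal.ofReal_mul (by positivity)]
        apply ENNReal.ofReal_le_ofReal
        have e1 : w ^ (1 - a + b) = w * w ^ (-a) * w ^ b := by
          rw [sub_eq_add_neg, Real.rpow_add hw, Real.rpow_add hw, Real.rpow_one]
        have e2 : (1 : ℝ) / 2 ≤ 2 ^ (-a) := by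
          rw [one_div, ← Real.rpow_neg_one]
          exact Real.rpow_le_rpow_of_exponent_le one_le_two (by linarith)
        have e3 : 0 < w * w ^ (-a) * w ^ b := by positivity
        rw [e1, hA, Real.mul_rpow zero_le_two hw.le]
        nlinarith
    _ = eLpNorm (J.indicator fun _ => A * w / 2) q lebesgue01 := by
        rw [eLpNorm_indicator_const' measurableSet_Icc hJ0 (by positivity), hJvol,
          Real.enorm_of_nonneg (by positivity), one_div, ← ENNReal.toReal_inv]
    _ ≤ eLpNorm (tent A c w) q lebesgue01 := by
        refine eLpNorm_mono fun t => ?_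
        by_cases ht : t ∈ J
        · rw [indicator_of_mem ht, Real.norm_of_nonneg (by positivity), tent,
            Real.norm_of_nonneg (by positivity)]
          have : |t - c| ≤ w / 2 := abs_le.2 ⟨by linarith [ht.1], by linarith [ht.2]⟩
          have : w / 2 ≤ max 0 (w - |t - c|) := le_max_of_le_right (by linarith)
          nlinarith
        · rw [indicator_of_notMem ht, norm_zero]
          exact norm_nonneg _

lemma rpow_le_radius_of_mem_avoid_cell {p q : ℝ≥0∞} (hp : 1 ≤ p) (hq : 1 ≤ q) {n m j : ℕ}
    (hj : j < m) {x : Fin n → unitInterval} (hx : x ∈ avoid n (cell m j)) :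
    ENNReal.ofReal ((1 / (2 * m)) ^ (1 - p⁻¹.toReal + q⁻¹.toReal) / 8) ≤ radius p q x := by
  have hm : (0 : ℝ) < m := by exact_mod_cast (Nat.zero_le j).trans_lt hj
  have e1 : (j : ℝ) / m = (2 * j + 1) / (2 * m) - 1 / (2 * m) := by
    field_simp
    ring
  have e2 : ((j : ℝ) + 1) / m = (2 * j + 1) / (2 * m) + 1 / (2 * m) := by
    field_simp
    ring
  refine rpow_le_radius hp hq (c := (2 * j + 1) / (2 * m)) (by positivity) ?_ ?_ ?_
  · rw [← e1]
    positivity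
  · rw [← e2]
    exact cell_right_le_one hj
  · rwa [← e1, ← e2]

/-- The lower bound for optimal nodes in the case `p ≤ q`. -/
lemma le_optimalRadius {p q : ℝ≥0∞} (hp : 1 ≤ p) (hq : 1 ≤ q) (n : ℕ) :
    ENNReal.ofReal ((1 / (2 * (n + 1 : ℕ))) ^ (1 - p⁻¹.toReal + q⁻¹.toReal) / 8)
      ≤ optimalRadius p q n := by
  refine le_iInf fun x => ?_
  -- Pigeonhole: `n` nodes cannot meet all of `n + 1` disjoint cells.
  suffices ∃ j < n + 1, x ∈ avoid n (cell (n + 1) j) by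
    obtain ⟨j, hj, hx⟩ := this
    exact rpow_le_radius_of_mem_avoid_cell hp hq hj hx
  by_contra! hall
  have hex : ∀ j : Fin (n + 1), ∃ i, (x i : ℝ) ∈ cell (n + 1) j := by
    intro j
    have := hall j j.2
    simpa [avoid] using this
  choose i hi using hex
  have hinj : Function.Injective i := by
    intro j k hjk
    by_contra hne
    have hd := disjoint_cell (m := n + 1) fun h : (j : ℕ) = k => hne (Fin.ext h)
    have := hi k
    rw [← hjk] at this
    exact Set.disjoint_left.1 hd (hi j) this
  have := Fintype.card_le_of_injective i hinj
  simp at this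

/-- The lower bound for the expected radius in the case `p ≤ q`. -/
lemma le_expectedRadius {p q : ℝ≥0∞} (hp : 1 ≤ p) (hq : 1 ≤ q) {n m : ℕ} (hm2 : 2 ≤ m)
    (hm : 1 ≤ (m : ℝ) * (1 - 1 / m) ^ n) :
    ENNReal.ofReal ((1 / (2 * m)) ^ (1 - p⁻¹.toReal + q⁻¹.toReal) / 8) * (1 / 2)
      ≤ expectedRadius p q n := by
  set B := ENNReal.ofReal ((1 / (2 * m)) ^ (1 - p⁻¹.toReal + q⁻¹.toReal) / 8)
  set G : Set (Fin n → unitInterval) := ⋃ j : Fin m, avoid n (cell m j)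
  have hG : MeasurableSet G :=
    MeasurableSet.iUnion fun j => measurableSet_avoid (measurableSet_cell m j)
  calc B * (1 / 2) ≤ B * volume G := by
        gcongr
        exact half_le_volume_exists_avoid hm hm2
    _ = ∫⁻ x, G.indicator (fun _ => B) x := by
        rw [lintegral_indicator hG, setLIntegral_const]
    _ ≤ expectedRadius p q n := by
        refine lintegral_mono fun x => ?_
        by_cases hx : x ∈ G
        · rw [indicator_of_mem hx]
          obtain ⟨j, hj⟩ := mem_iUnion.1 hx
          exact rpow_le_radius_of_mem_avoid_cell hp hq j.2 hj
        · rw [indicator_of_notMem hx]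
          exact zero_le

/-- The lower bound for optimal nodes, for arbitrary `p` and `q`. -/
lemma inv_le_optimalRadius {p q : ℝ≥0∞} (hp : 1 ≤ p) (hq : 1 ≤ q) {n : ℕ} (hn : n ≠ 0) :
    ENNReal.ofReal (1 / (16 * n)) ≤ optimalRadius p q n := by
  refine le_iInf fun x => ?_
  have hn0 : (0 : ℝ) < n := by positivity
  have : NeZero n := ⟨hn⟩
  set S : Set ℝ := range fun i => (x i : ℝ) with hS
  have hSne : S.Nonempty := range_nonempty _
  set h : ℝ → ℝ := fun t => 2⁻¹ * Metric.infDist t S with hh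
  have hd : ∀ t, 0 ≤ Metric.infDist t S := fun t => Metric.infDist_nonneg
  have hlip : LipschitzWith 2⁻¹ h := by
    refine LipschitzWith.of_dist_le_mul fun s t => ?_
    have := (Metric.lipschitz_infDist_pt S).dist_le_mul s t
    rw [NNReal.coe_one, one_mul, Real.dist_eq] at this
    rw [Real.dist_eq, hh]
    beta_reduce
    rw [← mul_sub, abs_mul]
    push_cast
    rw [abs_of_nonneg (by norm_num)]
    gcongr
  have hnorm : ∀ {g : ℝ → ℝ}, (∀ t ∈ Icc (0 : ℝ) 1, ‖g t‖ ≤ 2⁻¹) →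
      eLpNorm g p lebesgue01 ≤ 2⁻¹ := by
    intro g hg
    have := eLpNorm_le_of_ae_bound (p := p) (μ := lebesgue01) (f := g) (C := 2⁻¹) (by
      filter_upwards [ae_restrict_mem measurableSet_Icc] with t ht using hg t ht)
    rw [ENNReal.ofReal_inv_of_pos two_pos] at this
    simpa using this
  have hball : h ∈ unitBall p := by
    refine mem_unitBall_of_lipschitzWith hp hlip (hnorm fun t ht => ?_) (hnorm fun t _ => ?_)
    · rw [hh, norm_mul, Real.norm_of_nonneg (by norm_num), Real.norm_of_nonneg (hd t)]
      have h1 : Metric.infDist t S ≤ dist t (x 0) := Metric.infDist_le_dist_of_mem ⟨0, rfl⟩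
      have h2 : dist t (x 0) ≤ 1 := by
        rw [Real.dist_eq, abs_le]
        constructor <;> linarith [ht.1, ht.2, (x 0).2.1, (x 0).2.2]
      linarith
    · have := norm_deriv_le_of_lipschitz (x₀ := t) hlip
      simpa using this
  have hzero : ∀ i, h (x i) = 0 := fun i => by
    simp only [hh]
    have : (x i : ℝ) ∈ S := ⟨i, rfl⟩
    rw [Metric.infDist_zero_of_mem this, mul_zero]
  refine le_trans ?_ (eLpNorm_le_radius hq hball hzero)
  refine le_trans ?_ (eLpNorm_le_eLpNorm_of_exponent_le hq hlip.continuous.aestronglyMeasurable)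
  rw [eLpNorm_one_eq_lintegral_enorm]
  -- The `δ`-balls around the nodes cover at most half of `[0,1]`, and outside them `h ≥ δ/2`. The
  -- `L_1` norm is therefore at least `δ/4 = 1/(16n)`, and it is a lower bound for the `L_q` norm.
  set δ : ℝ := 1 / (4 * n) with hδ
  have hδ0 : 0 < δ := by positivity
  set N : Set ℝ := ⋃ i, Metric.ball (x i : ℝ) δ
  have hNm : MeasurableSet N := MeasurableSet.iUnion fun i => Metric.isOpen_ball.measurableSet
  have hN : lebesgue01 N ≤ 2⁻¹ := by
    calc lebesgue01 N ≤ ∑ i : Fin n, lebesgue01 (Metric.ball (x i : ℝ) δ) :=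
          measure_iUnion_fintype_le _ _
      _ ≤ ∑ i : Fin n, ENNReal.ofReal (2 * δ) := by
          refine Finset.sum_le_sum fun i _ => ?_
          exact (Measure.restrict_apply_le _ _).trans_eq (Real.volume_ball _ _)
      _ = 2⁻¹ := by
          rw [Finset.sum_const, Finset.card_univ, Fintype.card_fin, nsmul_eq_mul,
            ← ENNReal.ofReal_natCast, ← ENNReal.ofReal_mul hn0.le]
          have : (n : ℝ) * (2 * δ) = 2⁻¹ := by
            rw [hδ]
            field_simp
            norm_num
          rw [this, ENNReal.ofReal_inv_of_pos two_pos, ENNReal.ofReal_ofNat]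
  have hNc : 2⁻¹ ≤ lebesgue01 Nᶜ := by
    rw [prob_compl_eq_one_sub hNm]
    refine le_trans ?_ (tsub_le_tsub_left hN 1)
    rw [ENNReal.one_sub_inv_two]
  calc ENNReal.ofReal (1 / (16 * n)) = ENNReal.ofReal (δ / 2) * 2⁻¹ := by
        rw [← ENNReal.ofReal_ofNat 2, ← ENNReal.ofReal_inv_of_pos two_pos,
          ← ENNReal.ofReal_mul (by positivity), hδ]
        congr 1
        field_simp
        norm_num
    _ ≤ ENNReal.ofReal (δ / 2) * lebesgue01 Nᶜ := by gcongr
    _ = ∫⁻ t, Nᶜ.indicator (fun _ => ENNReal.ofReal (δ / 2)) t ∂lebesgue01 := by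
        rw [lintegral_indicator hNm.compl, setLIntegral_const]
    _ ≤ ∫⁻ t, ‖h t‖ₑ ∂lebesgue01 := by
        refine lintegral_mono fun t => ?_
        by_cases ht : t ∈ Nᶜ
        · rw [indicator_of_mem ht, Real.enorm_of_nonneg (mul_nonneg (by norm_num) (hd t))]
          apply ENNReal.ofReal_le_ofReal
          have : δ ≤ Metric.infDist t S := by
            refine (Metric.le_infDist hSne).2 ?_
            rintro _ ⟨i, rfl⟩
            by_contra! hlt
            exact ht (mem_iUnion.2 ⟨i, hlt⟩)
          have : δ / 2 ≤ 2⁻¹ * Metric.infDist t S := by linarith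
          exact this
        · rw [indicator_of_notMem ht]
          exact zero_le

/-! ### From the bounds to the rates. -/

lemma optimalRadius_le_expectedRadius (p q : ℝ≥0∞) (n : ℕ) :
    optimalRadius p q n ≤ expectedRadius p q n := by
  calc optimalRadius p q n = ∫⁻ _ : Fin n → unitInterval, optimalRadius p q n := by simp
    _ ≤ _ := lintegral_mono fun x => iInf_le _ x

lemma Asymp.symm {n₀ : ℕ} {a b : ℕ → ℝ≥0∞} (h : Asymp n₀ a b) : Asymp n₀ b a := by
  obtain ⟨C, hC, h⟩ := h
  exact ⟨C, hC, fun n hn => (h n hn).symm⟩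

lemma Asymp.trans {n₀ : ℕ} {a b c : ℕ → ℝ≥0∞} (h : Asymp n₀ a b) (h' : Asymp n₀ b c) :
    Asymp n₀ a c := by
  obtain ⟨C, hC, h⟩ := h
  obtain ⟨C', hC', h'⟩ := h'
  refine ⟨C * C', by positivity, fun n hn => ⟨?_, ?_⟩⟩
  · calc a n ≤ C * b n := (h n hn).1
      _ ≤ C * (C' * c n) := by gcongr; exact (h' n hn).1
      _ = _ := by push_cast; ring
  · calc c n ≤ C' * b n := (h' n hn).2
      _ ≤ C' * (C * a n) := by gcongr; exact (h n hn).2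
      _ = _ := by push_cast; ring

lemma asymp_ofReal {n₀ : ℕ} {a : ℕ → ℝ≥0∞} {Y : ℕ → ℝ} {C : ℝ} (hC : 0 < C)
    (h : ∀ n, n₀ ≤ n → a n ≤ ENNReal.ofReal (C * Y n) ∧ ENNReal.ofReal (Y n / C) ≤ a n) :
    Asymp n₀ a fun n => ENNReal.ofReal (Y n) := by
  refine ⟨C.toNNReal, by simpa using hC, fun n hn => ⟨?_, ?_⟩⟩
  · refine (h n hn).1.trans_eq ?_
    rw [ENNReal.ofReal_mul hC.le, ENNReal.ofReal]
  · calc ENNReal.ofReal (Y n) = ENNReal.ofReal (C * (Y n / C)) := by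
          rw [mul_div_cancel₀ _ hC.ne']
      _ = ENNReal.ofReal C * ENNReal.ofReal (Y n / C) := ENNReal.ofReal_mul hC.le
      _ ≤ _ := by
        rw [ENNReal.ofReal]
        gcongr
        exact (h n hn).2

/-- For `0 ≤ β ≤ 1` and `K ≥ 1` one has `K^β ≤ K`, so the constants do not depend on the exponent.
The same holds in `le_div_rpow`. -/
lemma div_rpow_le {β K z y : ℝ} (hβ0 : 0 ≤ β) (hβ1 : β ≤ 1) (hK : 1 ≤ K) (hy : 0 < y)
    (hz0 : 0 ≤ z) (hz : z ≤ K / y) : z ^ β ≤ K * y ^ (-β) := by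
  calc z ^ β ≤ (K / y) ^ β := Real.rpow_le_rpow hz0 hz hβ0
    _ = K ^ β * y ^ (-β) := by
      rw [Real.div_rpow (by linarith) hy.le, Real.rpow_neg hy.le, div_eq_mul_inv]
    _ ≤ _ := by
      gcongr
      exact (Real.rpow_le_rpow_of_exponent_le hK hβ1).trans_eq (Real.rpow_one K)

lemma le_div_rpow {β K z y : ℝ} (hβ0 : 0 ≤ β) (hβ1 : β ≤ 1) (hK : 1 ≤ K) (hy : 0 < y)
    (hz : 1 / (K * y) ≤ z) : y ^ (-β) / K ≤ z ^ β := by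
  have hK0 : 0 < K := by linarith
  calc y ^ (-β) / K ≤ y ^ (-β) / K ^ β := by
        gcongr
        exact (Real.rpow_le_rpow_of_exponent_le hK hβ1).trans_eq (Real.rpow_one K)
    _ = (1 / (K * y)) ^ β := by
        rw [Real.div_rpow zero_le_one (by positivity), Real.one_rpow,
          Real.mul_rpow hK0.le hy.le, Real.rpow_neg hy.le]
        field_simp
    _ ≤ z ^ β := Real.rpow_le_rpow (by positivity) hz hβ0

section Numerics

variable {n : ℕ}

lemma half_le_log (hn : 2 ≤ n) : 1 / 2 ≤ Real.log n := by
  have h1 : Real.log 2 ≤ Real.log n := Real.log_le_log two_pos (by exact_mod_cast hn)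
  linarith [Real.log_two_gt_d9]

lemma two_le_div_log (hn : 2 ≤ n) : 2 ≤ (n : ℝ) / Real.log n := by
  have hl := half_le_log hn
  have hn0 : (0 : ℝ) < n := by positivity
  rw [le_div_iff₀ (by linarith)]
  have h1 := Real.log_le_sub_one_of_pos (x := (n : ℝ) / 2) (by positivity)
  rw [Real.log_div hn0.ne' two_ne_zero] at h1
  linarith [Real.log_two_lt_d9]

lemma half_le_floor {y : ℝ} (hy : 1 ≤ y) : y / 2 ≤ ⌊y⌋₊ := by
  have h1 : (1 : ℝ) ≤ ⌊y⌋₊ := by exact_mod_cast (Nat.one_le_floor_iff y).2 hy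
  have h2 := Nat.lt_floor_add_one y
  linarith

lemma exp_neg_two_mul_le {u : ℝ} (h0 : 0 ≤ u) (h1 : u ≤ 1 / 2) : Real.exp (-(2 * u)) ≤ 1 - u := by
  rw [Real.exp_neg, inv_le_comm₀ (Real.exp_pos _) (by linarith)]
  refine le_trans ?_ (Real.add_one_le_exp (2 * u))
  rw [inv_le_iff_one_le_mul₀ (by linarith)]
  nlinarith

/-- With this many cells `(1 - 1/m)^n ≥ exp (-2n/m) ≥ n^(-1/2)`, while `m ≥ √n`. -/
lemma one_le_mul_one_sub_pow (hn : 2 ≤ n) {m : ℕ} (hm : 4 * ((n : ℝ) / Real.log n) ≤ m) :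
    1 ≤ (m : ℝ) * (1 - 1 / m) ^ n := by
  have hl := half_le_log hn
  have hy := two_le_div_log hn
  have hn0 : (0 : ℝ) < n := by positivity
  have hm8 : (8 : ℝ) ≤ m := by linarith
  have hm0 : (0 : ℝ) < m := by linarith
  have hinv : 1 / (m : ℝ) ≤ 1 / 2 := one_div_le_one_div_of_le two_pos (by linarith)
  have hnm : (n : ℝ) / m ≤ Real.log n / 4 := by
    rw [div_le_iff₀ hm0]
    have := mul_le_mul_of_nonneg_left hm (by positivity : 0 ≤ Real.log n / 4)
    have h2 : Real.log n / 4 * (4 * ((n : ℝ) / Real.log n)) = n := by field_simp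
    linarith
  have hsq : 0 < √(n : ℝ) := Real.sqrt_pos.2 hn0
  have hss : √(n : ℝ) * √(n : ℝ) = n := Real.mul_self_sqrt hn0.le
  have hlog : Real.log n = 2 * Real.log √(n : ℝ) := by
    rw [Real.log_sqrt hn0.le]
    ring
  have hlog2 := Real.log_le_sub_one_of_pos hsq
  have h1 : (√(n : ℝ))⁻¹ ≤ (1 - 1 / m) ^ n := by
    calc (√(n : ℝ))⁻¹ = Real.exp (-(Real.log n / 2)) := by
          rw [Real.exp_neg, hlog, mul_div_cancel_left₀ _ two_ne_zero, Real.exp_log hsq]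
      _ ≤ Real.exp (n * (-(2 * (1 / m)))) := by
          apply Real.exp_le_exp.2
          have : (n : ℝ) * (-(2 * (1 / m))) = -(2 * (n / m)) := by ring
          rw [this]
          linarith
      _ = Real.exp (-(2 * (1 / m))) ^ n := Real.exp_nat_mul _ _
      _ ≤ _ := by
          gcongr
          exact exp_neg_two_mul_le (by positivity) hinv
  have h2 : √(n : ℝ) ≤ m := by
    refine le_trans ?_ hm
    rw [mul_div_assoc', le_div_iff₀ (by linarith)]
    nlinarith
  calc (1 : ℝ) = √(n : ℝ) * (√(n : ℝ))⁻¹ := (mul_inv_cancel₀ hsq.ne').symm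
    _ ≤ _ := by gcongr

/-- Here `n/m ≥ 2 log n`, so the exponential is at most `n^(-2)`, and `m ≤ n` leaves `1/n`. -/
lemma mul_exp_neg_le (hn : 2 ≤ n) {m : ℕ} (hm0 : m ≠ 0)
    (hm : (m : ℝ) ≤ (n : ℝ) / Real.log n / 2) :
    m * Real.exp (-(n / m)) ≤ 2 / ((n : ℝ) / Real.log n) := by
  have hl := half_le_log hn
  have hn0 : (0 : ℝ) < n := by positivity
  have hmp : (0 : ℝ) < m := by positivity
  have hnm : 2 * Real.log n ≤ n / m := by
    rw [le_div_iff₀ hmp]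
    have := mul_le_mul_of_nonneg_left hm (by linarith : 0 ≤ 2 * Real.log n)
    have h2 : 2 * Real.log n * ((n : ℝ) / Real.log n / 2) = n := by field_simp
    linarith
  have hexp : Real.exp (-(n / m)) ≤ (n : ℝ)⁻¹ * (n : ℝ)⁻¹ := by
    calc Real.exp (-(n / m)) ≤ Real.exp (-Real.log n + -Real.log n) :=
          Real.exp_le_exp.2 (by linarith)
      _ = _ := by rw [Real.exp_add, Real.exp_neg, Real.exp_log hn0]
  have hmn : (m : ℝ) ≤ n := by
    refine hm.trans ?_
    rw [div_div, div_le_iff₀ (by linarith)]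
    nlinarith
  calc m * Real.exp (-(n / m)) ≤ n * ((n : ℝ)⁻¹ * (n : ℝ)⁻¹) := by gcongr
    _ = 1 / n := by field_simp
    _ ≤ 2 / ((n : ℝ) / Real.log n) := by
      rw [div_div_eq_mul_div]
      gcongr
      linarith

end Numerics

/-- The rate of the expected radius in the case `p ≤ q`. -/
lemma asymp_expectedRadius {p q : ℝ≥0∞} (hp : 1 ≤ p) (hpq : p ≤ q) :
    Asymp 2 (expectedRadius p q) fun n => ENNReal.ofReal
      (((n : ℝ) / Real.log n) ^ (-(1 - p⁻¹.toReal + q⁻¹.toReal))) := by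
  have hq := hp.trans hpq
  set β := 1 - p⁻¹.toReal + q⁻¹.toReal with hβ
  have hβ0 : 0 ≤ β :=
    add_nonneg (IsPartition.one_sub_inv_toReal_nonneg hp) ENNReal.toReal_nonneg
  have hβ1 : β ≤ 1 := by
    have : q⁻¹.toReal ≤ p⁻¹.toReal := ENNReal.toReal_mono
      (ENNReal.inv_ne_top.2 (by positivity)) (ENNReal.inv_le_inv.2 hpq)
    linarith
  -- The lower bound requires `160 = 10 * 8 * 2`: from the cell count, the tent, and the probability
  -- `1/2`. The upper bound needs only `2 * 8 + 2 * 2`.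
  refine asymp_ofReal (C := 160) (by norm_num) fun n hn => ⟨?_, ?_⟩
  all_goals
    have hy := two_le_div_log hn
    have hm' := fun m : ℕ => one_le_mul_one_sub_pow (m := m) hn
    have hexp := fun m : ℕ => mul_exp_neg_le (m := m) hn
    set y : ℝ := (n : ℝ) / Real.log n
    have hy0 : 0 < y := by linarith
    have hyβ : 0 < y ^ (-β) := by positivity
  -- With about `y/2` cells an empty one is unlikely; the lower bound takes about `4y` cells, where
  -- an empty one is likely.
  · have hfl := half_le_floor (y := y / 2) (by linarith)
    have hfl' := Nat.floor_le (a := y / 2) (by positivity)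
    set m := ⌊y / 2⌋₊
    have hm0 : (0 : ℝ) < m := by linarith
    have hm : m ≠ 0 := by
      rintro h
      simp [h] at hm0
    have h1 : (2 * (1 / (m : ℝ))) ^ β ≤ 8 * y ^ (-β) := by
      refine div_rpow_le hβ0 hβ1 (by norm_num) hy0 (by positivity) ?_
      rw [mul_one_div, div_le_div_iff₀ hm0 hy0]
      linarith
    have h2 : m * Real.exp (-(n / m)) ≤ 2 * y ^ (-β) := by
      refine (hexp m hm hfl').trans ?_
      rw [div_eq_mul_inv, ← Real.rpow_neg_one]
      gcongr
      · linarith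
    refine (expectedRadius_le hp hpq (by omega) hm).trans ?_
    rw [← hβ, ENNReal.ofReal_rpow_of_pos (by positivity), mul_comm, ← ENNReal.ofReal_ofNat 2,
      ← ENNReal.ofReal_mul zero_le_two, ← ENNReal.ofReal_mul zero_le_two,
      ← ENNReal.ofReal_add (by positivity) (by positivity)]
    apply ENNReal.ofReal_le_ofReal
    linarith
  · set m := ⌈4 * y⌉₊
    have hm1 : 4 * y ≤ m := Nat.le_ceil _
    have hm2 : (m : ℝ) < 4 * y + 1 := Nat.ceil_lt_add_one (by positivity)
    have hm3 : 2 ≤ m := by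
      have : (2 : ℝ) ≤ m := by linarith
      exact_mod_cast this
    have hm0 : (0 : ℝ) < m := by linarith
    refine le_trans ?_ (le_expectedRadius hp hq hm3 (hm' m hm1))
    have h1 : y ^ (-β) / 10 ≤ (1 / (2 * (m : ℝ))) ^ β := by
      refine le_div_rpow hβ0 hβ1 (by norm_num) hy0 ?_
      apply one_div_le_one_div_of_le (by positivity)
      linarith
    have h2 : (1 / 2 : ℝ≥0∞) = ENNReal.ofReal (1 / 2) := by
      rw [ENNReal.ofReal_div_of_pos two_pos]
      simp
    rw [h2, ← ENNReal.ofReal_mul (by positivity), ← hβ]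
    apply ENNReal.ofReal_le_ofReal
    linarith

/-- The rate of the radius of optimal information in the case `p ≤ q`. -/
lemma asymp_optimalRadius {p q : ℝ≥0∞} (hp : 1 ≤ p) (hpq : p ≤ q) :
    Asymp 2 (fun n => optimalRadius p q ⌊(n : ℝ) / Real.log n⌋₊) fun n => ENNReal.ofReal
      (((n : ℝ) / Real.log n) ^ (-(1 - p⁻¹.toReal + q⁻¹.toReal))) := by
  have hq := hp.trans hpq
  set β := 1 - p⁻¹.toReal + q⁻¹.toReal with hβ
  have hβ0 : 0 ≤ β :=
    add_nonneg (IsPartition.one_sub_inv_toReal_nonneg hp) ENNReal.toReal_nonneg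
  have hβ1 : β ≤ 1 := by
    have : q⁻¹.toReal ≤ p⁻¹.toReal := ENNReal.toReal_mono
      (ENNReal.inv_ne_top.2 (by positivity)) (ENNReal.inv_le_inv.2 hpq)
    linarith
  refine asymp_ofReal (C := 160) (by norm_num) fun n hn => ?_
  have hy := two_le_div_log hn
  set y : ℝ := (n : ℝ) / Real.log n
  have hy0 : 0 < y := by linarith
  have hyβ : 0 < y ^ (-β) := by positivity
  have hfl := half_le_floor (y := y) (by linarith)
  have hfl' := Nat.floor_le hy0.le
  set m := ⌊y⌋₊
  have hm0 : (0 : ℝ) < m := by linarith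
  have hm : m ≠ 0 := by
    rintro h
    simp [h] at hm0
  constructor
  · have h1 : (2 * (1 / (m : ℝ))) ^ β ≤ 4 * y ^ (-β) := by
      refine div_rpow_le hβ0 hβ1 (by norm_num) hy0 (by positivity) ?_
      rw [mul_one_div, div_le_div_iff₀ hm0 hy0]
      linarith
    refine (optimalRadius_le hp hpq hm).trans ?_
    rw [← hβ, ENNReal.ofReal_rpow_of_pos (by positivity), mul_comm, ← ENNReal.ofReal_ofNat 2,
      ← ENNReal.ofReal_mul zero_le_two]
    apply ENNReal.ofReal_le_ofReal
    linarith
  · refine le_trans ?_ (le_optimalRadius hp hq m)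
    have h1 : y ^ (-β) / 4 ≤ (1 / (2 * ((m + 1 : ℕ) : ℝ))) ^ β := by
      refine le_div_rpow hβ0 hβ1 (by norm_num) hy0 ?_
      apply one_div_le_one_div_of_le (by positivity)
      push_cast
      linarith
    rw [← hβ]
    apply ENNReal.ofReal_le_ofReal
    linarith

/-- In the case `q < p`, a sequence between the optimal and the expected radius is of order
`n⁻¹`. -/
lemma asymp_inv_of_between {p q : ℝ≥0∞} (hp : 1 ≤ p) (hq : 1 ≤ q) (hqp : q < p)
    {a : ℕ → ℝ≥0∞} (ha : ∀ n, optimalRadius p q n ≤ a n)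
    (ha' : ∀ n, a n ≤ expectedRadius p q n) :
    Asymp 1 a fun n => ENNReal.ofReal ((n : ℝ) ^ (-1 : ℝ)) := by
  obtain ⟨C, hC, h⟩ := exists_expectedRadius_le hq hqp
  refine asymp_ofReal (C := max C.toReal 16) (by positivity) fun n hn => ?_
  have hn' : n ≠ 0 := by omega
  have hn0 : (0 : ℝ) < n := by positivity
  have h16 : (16 : ℝ) ≤ max C.toReal 16 := le_max_right _ _
  rw [Real.rpow_neg_one]
  constructor
  · refine ((ha' n).trans (h n hn')).trans ?_
    rw [ENNReal.ofReal_mul (by positivity), ENNReal.ofReal_inv_of_pos hn0, ENNReal.ofReal_natCast]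
    gcongr
    rw [← ENNReal.ofReal_toReal hC]
    apply ENNReal.ofReal_le_ofReal
    rw [ENNReal.ofReal_toReal hC]
    exact le_max_left _ _
  · refine le_trans ?_ ((inv_le_optimalRadius hp hq hn').trans (ha n))
    apply ENNReal.ofReal_le_ofReal
    rw [inv_eq_one_div, div_div, mul_comm]
    gcongr

end RandomInfo

theorem mainTheorem2 (p q : ℝ≥0∞) (hp : 1 ≤ p) (hq : 1 ≤ q) :
    (∀ n : ℕ, AEMeasurable (fun x : Fin n → unitInterval => RandomInfo.radius p q x) volume) ∧
    (q < p →
      RandomInfo.Asymp 1 (RandomInfo.expectedRadius p q) (RandomInfo.optimalRadius p q) ∧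
      RandomInfo.Asymp 1 (RandomInfo.optimalRadius p q)
        (fun n => ENNReal.ofReal ((n : ℝ) ^ (-1 : ℝ)))) ∧
    (p ≤ q →
      RandomInfo.Asymp 2 (RandomInfo.expectedRadius p q)
        (fun n => RandomInfo.optimalRadius p q ⌊(n : ℝ) / Real.log n⌋₊) ∧
      RandomInfo.Asymp 2 (fun n => RandomInfo.optimalRadius p q ⌊(n : ℝ) / Real.log n⌋₊)
        (fun n => ENNReal.ofReal
          (((n : ℝ) / Real.log n) ^ (-1 + p⁻¹.toReal - q⁻¹.toReal)))) := by
  refine ⟨RandomInfo.aemeasurable_radius hp hq, fun hqp => ?_, fun hpq => ?_⟩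
  · have hle := RandomInfo.optimalRadius_le_expectedRadius p q
    have hE := RandomInfo.asymp_inv_of_between hp hq hqp hle fun _ => le_rfl
    have hO := RandomInfo.asymp_inv_of_between hp hq hqp (fun _ => le_rfl) hle
    exact ⟨hE.trans hO.symm, hO⟩
  · have hexp : -1 + p⁻¹.toReal - q⁻¹.toReal = -(1 - p⁻¹.toReal + q⁻¹.toReal) := by ring
    have hO := RandomInfo.asymp_optimalRadius hp hpq
    rw [hexp]
    exact ⟨(RandomInfo.asymp_expectedRadius hp hpq).trans hO.symm, hO⟩
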